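/- Let $d\ge 1$ and let $r$ be a natural number. Consider the random-design regression model $$Y_i=g(X_i)+\sigma(X_i)e_i,\qquad i=1,2,\dots,$$ where $(X_i)$ is an i.i.d. sequence of random vectors in $\mathbb R^d$, $(e_i)$ is an i.i.d. sequence of real random variables, independent of the sequence $(X_i)$, with $\mathbb E[e_1]=0$ and $\mathbb E[e_1^2]<\infty$, and $g,\sigma:\mathbb R^d\to\mathbb R$ are measurable. Let $Q\subset\mathbb R^d$ be nonempty, bounded and convex, and let $\psi:\mathbb R^d\to\mathbb R$ be measurable and zero outside $Q$. Assume the following. 1. $X_1$ has a bounded density $f$ on $\mathbb R^d$, which is $r$ times differentiable with bounded $r$-th derivative. 2. There is $b>0$ such that $f(x)\ge b$ for every $x\in Q$. 3. $K:\mathbb R^d\to\mathbb R$ is a measurable symmetric kernel of order $r$, that is, $K(-x)=K(x)$, $\int K(x)\,dx=1$ and $\int x_1^{l_1}\cdots x_d^{l_d}K(x)\,dx=0$ whenever $1\le l_1+\dots+l_d\le r-1$; and there are $C_1,C_2>0$ with $|K(x)|\le C_1\exp(-C_2\|x\|)$ for every $x$. 4. The functions $\psi$ and $g$ are Hölder on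 $Q$ (each for some exponent in $(0,1]$), and $\sigma$ is bounded. 5. The bandwidths $h=h_n>0$ satisfy $n^{1/2}h^r\to 0$ and $n^{1/2}h^d\to+\infty$ as $n\to\infty$. Put $c=\int g(x)\psi(x)\,dx$ and $$\hat f^{(i)}(x)=\frac1{nh^d}\sum_{1\le j\le n,\ j\ne i}K\big(h^{-1}(X_j-x)\big),\qquad \hat c=\frac1n\sum_{i=1}^n\frac{Y_i\psi(X_i)}{\hat f^{(i)}(X_i)},\qquad \tilde c=\frac1n\sum_{i=1}^n\frac{Y_i\psi(X_i)}{f(X_i)},$$ a summand with zero denominator being set to $0$. Then $g\psi$ is integrable, the random variables $\frac{Y_1-g(X_1)}{f(X_1)}\psi(X_1)$ and $\frac{Y_1}{f(X_1)}\psi(X_1)$ are square-integrable, and $$n^{1/2}(\hat c-c)\overset{d}{\longrightarrow}\mathcal N(0,v),\qquad v=\operatorname{Var}\!\left(\frac{Y_1-g(X_1)}{f(X_1)}\,\psi(X_1)\right),$$ where $\mathcal N(0,0)$ denotes the point mass at $0$. Moreover $v$ is at most the variance obtained when the true density $f$ is used: for every $n\ge1$, $$v=\operatorname{Var}\!\left(\frac{Y_1}{f(X_1)}\psi(X_1)\right)-\operatorname{Var}\!\left(\frac{g(X_1)}{f(X_1)}\psi(X_1)\right)\le\operatorname{Var}\big(n^{1/2}(\tilde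 c-c)\big).$$ -/

import Mathlib

open MeasureTheory ProbabilityTheory Filter Topology
open scoped NNReal ENNReal

noncomputable section

/-- `φ` is Hölder on the set `Q`, for some exponent in `(0, 1]`. -/
def IsHolderOn {d : ℕ} (φ : EuclideanSpace ℝ (Fin d) → ℝ) (Q : Set (EuclideanSpace ℝ (Fin d))) :
    Prop :=
  ∃ C α : ℝ≥0, 0 < α ∧ α ≤ 1 ∧ HolderOnWith C α φ Q

/-- `f` is `r` times (Fréchet) differentiable on `ℝ^d`, with a bounded `r`-th derivative. -/
def HasBoundedDerivOfOrder {d : ℕ} (r : ℕ) (f : EuclideanSpace ℝ (Fin d) → ℝ) : Prop :=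
  (∀ k : ℕ, k < r → Differentiable ℝ (iteratedFDeriv ℝ k f)) ∧
    ∃ M : ℝ, ∀ x, ‖iteratedFDeriv ℝ r f x‖ ≤ M

/-- `f` is a probability density of the random vector `X`. -/
def IsDensityOf {Ω : Type*} [MeasurableSpace Ω] {d : ℕ} (P : Measure Ω)
    (X : Ω → EuclideanSpace ℝ (Fin d)) (f : EuclideanSpace ℝ (Fin d) → ℝ) : Prop :=
  Measurable f ∧ (∀ x, 0 ≤ f x) ∧
    P.map X = (volume : Measure (EuclideanSpace ℝ (Fin d))).withDensity
      (fun x => ENNReal.ofReal (f x))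

/-- `K` is a symmetric kernel of order `r` on `ℝ^d` with exponentially decreasing tails:
it integrates to one and its moments of total degree `1, …, r - 1` vanish (all these
integrals converge absolutely, because of the exponential bound). -/
structure IsExpKernelOfOrder {d : ℕ} (r : ℕ) (K : EuclideanSpace ℝ (Fin d) → ℝ) : Prop where
  measurable : Measurable K
  symmetric : ∀ x, K (-x) = K x
  integral_eq_one : ∫ x, K x = 1
  moments : ∀ l : Fin d → ℕ, 0 < ∑ i, l i → ∑ i, l i < r → ∫ x, (∏ i, x i ^ l i) * K x = 0
  exp_bound : ∃ C₁ C₂ : ℝ, 0 < C₁ ∧ 0 < C₂ ∧ ∀ x, |K x| ≤ C₁ * Real.exp (-C₂ * ‖x‖)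

/-- The leave-one-out kernel density estimate at `x`, built on the points `X j` with `j < n`,
`j ≠ i`, with kernel `K` and bandwidth `h`. -/
def looKDE {d : ℕ} (K : EuclideanSpace ℝ (Fin d) → ℝ) (h : ℝ) (n : ℕ)
    (X : ℕ → EuclideanSpace ℝ (Fin d)) (i : ℕ) (x : EuclideanSpace ℝ (Fin d)) : ℝ :=
  ((n : ℝ) * h ^ d)⁻¹ * ∑ j ∈ (Finset.range n).erase i, K (h⁻¹ • (X j - x))

/-- The estimator of `∫ g ψ` that uses the leave-one-out kernel estimate of the density. -/
def cHat {d : ℕ} (K : EuclideanSpace ℝ (Fin d) → ℝ) (h : ℝ) (ψ : EuclideanSpace ℝ (Fin d) → ℝ)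
    (n : ℕ) (X : ℕ → EuclideanSpace ℝ (Fin d)) (Y : ℕ → ℝ) : ℝ :=
  (n : ℝ)⁻¹ * ∑ i ∈ Finset.range n, Y i * ψ (X i) / looKDE K h n X i (X i)

/-- The estimator of `∫ g ψ` that uses the true density `f`. -/
def cTilde {d : ℕ} (f : EuclideanSpace ℝ (Fin d) → ℝ) (ψ : EuclideanSpace ℝ (Fin d) → ℝ)
    (n : ℕ) (X : ℕ → EuclideanSpace ℝ (Fin d)) (Y : ℕ → ℝ) : ℝ :=
  (n : ℝ)⁻¹ * ∑ i ∈ Finset.range n, Y i * ψ (X i) / f (X i)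

end

/-! ### Kernel smoothing: moments, bias of order `h ^ r`, convergence in `L¹`. -/

section Smoothing

variable {d : ℕ}

/-! Write φ = gψ, s = σψ and F_i for the leave-one-out estimate at X_i, so that Y_i ψ(X_i) = φ(X_i)
+ s(X_i) e_i. The heart of the matter is √n (ĉ - c) = n^{-1/2} ∑ s(X_i) e_i / f(X_i) + o(1) in
probability (`IsBoundedDensitySample.tendstoInMeasure_sub`); the central limit theorem and Slutsky's
lemma then give the limit law. The design leaves no trace at scale √n: estimating the density
cancels the fluctuations of φ(X_i) / f(X_i), which the true density would keep.

The cancellation comes from the exact identity 1/F = 2/f - F/f² + (F - f)²/(F f²). With w = φ/f² the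
linear part is n⁻¹ ∑ (2 w f - w F_i), an average plus a U-statistic. Writing K_h for smoothing at
scale h, its Hoeffding projection on one X_i is, up to a constant and a factor tending to 1 on the
smoothed terms, 2 w f - w K_h f - K_h (w f). This tends to 0 in mean square because both smoothed
terms approach w f. After scaling by √n, the degenerate part has second moment O(1/(n h^d)) and the
bias is O(√n h^r), since a kernel of order r annihilates the intermediate Taylor terms
(`IsExpKernelOfOrder.exists_bias_bound`). Hence the linear part is c + o(n^{-1/2}) in `L¹`
(`IsBoundedDensitySample.integral_abs_linearizedError_le`).

The quadratic part and the noise error ∑ s (1/F_i - 1/f) e_i are both controlled by the mean square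
error E (F_i - f)² = O(1/(n h^d) + h^{2r} + 1/n²), which is o(n^{-1/2}) under the bandwidth
conditions. All this requires F_i > b/2 wherever f(X_i) ≥ b. By a Bernstein bound this fails with
probability at most n exp(-κ n h^d), which tends to 0.

The variance comparison is orthogonality: Y ψ / f is a centred noise term plus a function of the
design, and the two are uncorrelated. -/

lemma integrable_norm_pow_mul_exp_neg_mul_norm (k : ℕ) {c : ℝ} (hc : 0 < c) :
    Integrable (fun u : EuclideanSpace ℝ (Fin d) => ‖u‖ ^ k * Real.exp (-c * ‖u‖)) := by
  have key : ∀ m : ℕ, ∀ t : ℝ, 0 ≤ t →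
      (1 + t) ^ m * Real.exp (-c * t) ≤ m.factorial * Real.exp c / c ^ m := by
    intro m t ht
    have h1 := Real.pow_div_factorial_le_exp (c * (1 + t)) (by positivity) m
    rw [div_le_iff₀ (by positivity), mul_pow, mul_add, mul_one, Real.exp_add] at h1
    rw [le_div_iff₀ (by positivity)]
    have h2 : Real.exp (c * t) * Real.exp (-c * t) = 1 := by
      rw [← Real.exp_add]; simp
    calc (1 + t) ^ m * Real.exp (-c * t) * c ^ m
        = (c ^ m * (1 + t) ^ m) * Real.exp (-c * t) := by ring
      _ ≤ (Real.exp c * Real.exp (c * t) * m.factorial) * Real.exp (-c * t) := by gcongr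
      _ = m.factorial * Real.exp c * (Real.exp (c * t) * Real.exp (-c * t)) := by ring
      _ = _ := by rw [h2, mul_one]
  -- The exponent `d + 1` exceeds the dimension; the exponential then has to absorb the power `k + d
  -- + 1`.
  have hint : Integrable (fun u : EuclideanSpace ℝ (Fin d) =>
      (1 + ‖u‖) ^ (-((d : ℝ) + 1))) := by
    apply integrable_one_add_norm
    simp
  refine (hint.const_mul (((k + d + 1).factorial : ℝ) * Real.exp c / c ^ (k + d + 1))).mono'
    (by fun_prop) (ae_of_all _ fun u => ?_)
  have hpos : 0 < 1 + ‖u‖ := by positivity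
  rw [Real.norm_of_nonneg (by positivity), Real.rpow_neg hpos.le, ← div_eq_mul_inv,
    le_div_iff₀ (by positivity)]
  refine le_trans ?_ (key (k + d + 1) ‖u‖ (norm_nonneg _))
  have h3 : (1 + ‖u‖) ^ ((d : ℝ) + 1) = (1 + ‖u‖) ^ (d + 1) := by
    rw [← Real.rpow_natCast]; push_cast; rfl
  rw [h3, add_assoc k d 1, pow_add (1 + ‖u‖) k]
  have : ‖u‖ ^ k ≤ (1 + ‖u‖) ^ k := by gcongr; linarith
  calc ‖u‖ ^ k * Real.exp (-c * ‖u‖) * (1 + ‖u‖) ^ (d + 1)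
      ≤ (1 + ‖u‖) ^ k * Real.exp (-c * ‖u‖) * (1 + ‖u‖) ^ (d + 1) := by gcongr
    _ = _ := by ring

namespace IsExpKernelOfOrder

variable {r : ℕ} {K : EuclideanSpace ℝ (Fin d) → ℝ}

lemma integrable_norm_pow_mul_abs (hK : IsExpKernelOfOrder r K) (k : ℕ) :
    Integrable (fun u => ‖u‖ ^ k * |K u|) := by
  obtain ⟨C₁, C₂, hC₁, hC₂, hb⟩ := hK.exp_bound
  have := hK.measurable
  refine ((integrable_norm_pow_mul_exp_neg_mul_norm (d := d) k hC₂).const_mul C₁).mono'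
    (by fun_prop) (ae_of_all _ fun u => ?_)
  rw [Real.norm_of_nonneg (by positivity)]
  calc ‖u‖ ^ k * |K u| ≤ ‖u‖ ^ k * (C₁ * Real.exp (-C₂ * ‖u‖)) := by gcongr; exact hb u
    _ = _ := by ring

lemma integrable (hK : IsExpKernelOfOrder r K) : Integrable K := by
  have h := hK.integrable_norm_pow_mul_abs 0
  simp only [pow_zero, one_mul] at h
  exact (integrable_norm_iff hK.measurable.aestronglyMeasurable).1 h

lemma exists_bound (hK : IsExpKernelOfOrder r K) : ∃ C : ℝ, 0 < C ∧ ∀ u, |K u| ≤ C := by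
  obtain ⟨C₁, C₂, hC₁, hC₂, hb⟩ := hK.exp_bound
  refine ⟨C₁, hC₁, fun u => (hb u).trans ?_⟩
  refine mul_le_of_le_one_right hC₁.le (Real.exp_le_one_iff.2 ?_)
  have := norm_nonneg u
  nlinarith

lemma integrable_mul_of_bounded (hK : IsExpKernelOfOrder r K) {G : EuclideanSpace ℝ (Fin d) → ℝ}
    (hG : Measurable G) {M : ℝ} (hM : ∀ u, |G u| ≤ M) : Integrable (fun u => K u * G u) :=
  hK.integrable.mul_bdd hG.aestronglyMeasurable (ae_of_all _ hM)

/-- Expanding `u` in the standard basis turns the form into monomials of total degree `k`, the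
exponent of a coordinate being the number of slots it occupies. This puts the moment condition in
the coordinate-free form that Taylor's formula with Fréchet derivatives needs. -/
lemma integral_multilinear_eq_zero (hK : IsExpKernelOfOrder r K) {k : ℕ} (hk : 0 < k)
    (hkr : k < r)
    (m : ContinuousMultilinearMap ℝ (fun _ : Fin k => EuclideanSpace ℝ (Fin d)) ℝ) :
    ∫ u, K u * m (fun _ => u) = 0 := by
  classical
  have hrep : ∀ u : EuclideanSpace ℝ (Fin d), m (fun _ => u) =
      ∑ s : Fin k → Fin d, (∏ j, u j ^ (Finset.univ.filter fun i => s i = j).card) *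
        m (fun i => EuclideanSpace.basisFun (Fin d) ℝ (s i)) := by
    intro u
    have hu : u = ∑ j, u j • EuclideanSpace.basisFun (Fin d) ℝ j := by
      simpa using ((EuclideanSpace.basisFun (Fin d) ℝ).sum_repr u).symm
    conv_lhs => rw [hu]
    rw [m.map_sum (fun _ j => u j • EuclideanSpace.basisFun (Fin d) ℝ j)]
    refine Finset.sum_congr rfl fun s _ => ?_
    rw [m.map_smul_univ, smul_eq_mul]
    congr 1
    rw [Finset.prod_comp (fun j => u j) s]
    refine (Finset.prod_subset (Finset.subset_univ _) fun j _ hj => ?_).trans ?_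
    · have : (Finset.univ.filter fun i => s i = j) = ∅ := by
        ext i; simp only [Finset.mem_filter, Finset.mem_univ, true_and, Finset.notMem_empty,
          iff_false]
        rintro rfl
        exact hj (Finset.mem_image_of_mem _ (Finset.mem_univ _))
      simp [this]
    · rfl
  have hcard : ∀ s : Fin k → Fin d, ∑ j, (Finset.univ.filter fun i => s i = j).card = k := by
    intro s
    have := Finset.card_eq_sum_card_fiberwise (f := s) (s := Finset.univ) (t := Finset.univ)
      (fun _ _ => Finset.mem_coe.2 (Finset.mem_univ _))
    simpa using this.symm
  have hzero : ∀ s : Fin k → Fin d,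
      ∫ u : EuclideanSpace ℝ (Fin d),
        (∏ j, u j ^ (Finset.univ.filter fun i => s i = j).card) * K u = 0 :=
    fun s => hK.moments _ (by rw [hcard]; exact hk) (by rw [hcard]; exact hkr)
  have hint : ∀ s : Fin k → Fin d, Integrable fun u : EuclideanSpace ℝ (Fin d) =>
      (∏ j, u j ^ (Finset.univ.filter fun i => s i = j).card) * K u := by
    intro s
    have := hK.measurable
    refine (hK.integrable_norm_pow_mul_abs k).mono' (by fun_prop) (ae_of_all _ fun u => ?_)
    rw [norm_mul, Real.norm_eq_abs (K u), norm_prod]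
    gcongr
    calc ∏ j, ‖u j ^ (Finset.univ.filter fun i => s i = j).card‖
        ≤ ∏ j, ‖u‖ ^ (Finset.univ.filter fun i => s i = j).card := by
          refine Finset.prod_le_prod (fun _ _ => norm_nonneg _) fun j _ => ?_
          rw [norm_pow]
          gcongr
          exact EuclideanSpace.norm_eq u ▸ (by
            rw [← EuclideanSpace.norm_eq u]; exact PiLp.norm_apply_le u j)
      _ = ‖u‖ ^ k := by rw [Finset.prod_pow_eq_pow_sum, hcard]
  calc ∫ u, K u * m (fun _ => u)
      = ∫ u : EuclideanSpace ℝ (Fin d), ∑ s : Fin k → Fin d,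
          ((∏ j, u j ^ (Finset.univ.filter fun i => s i = j).card) * K u) *
            m (fun i => EuclideanSpace.basisFun (Fin d) ℝ (s i)) := by
        congr 1 with u
        rw [hrep u, Finset.mul_sum]
        exact Finset.sum_congr rfl fun s _ => by ring
    _ = 0 := by
        rw [integral_finsetSum _ fun s _ => (hint s).mul_const _]
        refine Finset.sum_eq_zero fun s _ => ?_
        rw [integral_mul_const, hzero, zero_mul]

end IsExpKernelOfOrder

/-- The derivative of the remainder is the remainder of one order less for the shifted sequence, so
the mean value inequality on `[0, 1]` gives the induction. No continuity of the last derivative is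
needed; the factor `1 / r!` is given up. -/
lemma abs_sub_taylor_sum_le (r : ℕ) : ∀ (G : ℕ → ℝ → ℝ) (M : ℝ),
    (∀ k < r, ∀ t, HasDerivAt (G k) (G (k + 1) t) t) → (∀ t, |G r t| ≤ M) →
    ∀ t ∈ Set.Icc (0 : ℝ) 1,
      |G 0 t - ∑ k ∈ Finset.range r, G k 0 * (t ^ k / k.factorial)| ≤ M := by
  induction r with
  | zero => intro G M _ hM t _; simpa using hM t
  | succ r ih =>
    intro G M hG hM t ht
    have ih' := ih (fun k => G (k + 1)) M (fun k hk => hG (k + 1) (by omega)) hM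
    set ρ : ℝ → ℝ := fun t => G 0 t - ∑ k ∈ Finset.range (r + 1), G k 0 * (t ^ k / k.factorial)
    have hderiv : ∀ s, HasDerivAt ρ
        (G 1 s - ∑ k ∈ Finset.range r, G (k + 1) 0 * (s ^ k / k.factorial)) s := by
      intro s
      have h1 : HasDerivAt (fun t : ℝ => ∑ k ∈ Finset.range (r + 1),
          G k 0 * (t ^ k / k.factorial))
          (∑ k ∈ Finset.range (r + 1), G k 0 * ((k : ℝ) * s ^ (k - 1) / k.factorial)) s :=
        HasDerivAt.fun_sum fun k _ => ((hasDerivAt_pow k s).div_const _).const_mul _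
      rw [Finset.sum_range_succ' _ r] at h1
      simp only [Nat.cast_zero, zero_mul, zero_div, mul_zero, add_zero] at h1
      have h2 : ∑ k ∈ Finset.range r,
            G (k + 1) 0 * (((k + 1 : ℕ) : ℝ) * s ^ (k + 1 - 1) / (k + 1).factorial) =
          ∑ k ∈ Finset.range r, G (k + 1) 0 * (s ^ k / k.factorial) := by
        refine Finset.sum_congr rfl fun k _ => ?_
        rw [Nat.factorial_succ, Nat.add_sub_cancel]
        push_cast
        field_simp
      rw [h2] at h1
      exact (hG 0 (by omega) s).sub h1
    have hρ0 : ρ 0 = 0 := by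
      simp [ρ, Finset.sum_range_succ' _ r]
    have := norm_image_sub_le_of_norm_deriv_le_segment' (f := ρ) (a := 0) (b := 1) (C := M)
      (fun s _ => (hderiv s).hasDerivWithinAt)
      (fun s hs => ih' s ⟨hs.1, hs.2.le⟩) t ht
    rw [hρ0, sub_zero, sub_zero] at this
    have hM0 : 0 ≤ M := (abs_nonneg _).trans (hM 0)
    exact this.trans (mul_le_of_le_one_right hM0 ht.2)

lemma HasBoundedDerivOfOrder.exists_taylor_bound {r : ℕ} {f : EuclideanSpace ℝ (Fin d) → ℝ}
    (hf : HasBoundedDerivOfOrder r f) : ∃ M : ℝ, 0 ≤ M ∧ ∀ x u,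
      |f (x + u) - ∑ k ∈ Finset.range r,
        iteratedFDeriv ℝ k f x (fun _ => u) / k.factorial| ≤ M * ‖u‖ ^ r := by
  obtain ⟨hd, M, hM⟩ := hf
  refine ⟨M, (norm_nonneg _).trans (hM 0), fun x u => ?_⟩
  -- Taylor's formula along the segment from `x` to `x + u`, evaluated at its end.
  have := abs_sub_taylor_sum_le r (fun k t => iteratedFDeriv ℝ k f (x + t • u) (fun _ => u))
    (M * ‖u‖ ^ r) ?_ ?_ 1 (by simp)
  · simpa [iteratedFDeriv_zero_apply, div_eq_mul_inv] using this
  · intro k hk t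
    have h1 : HasDerivAt (fun t : ℝ => x + t • u) u t := by
      simpa using ((hasDerivAt_id t).smul_const u).const_add x
    have h2 := ((hd k hk) (x + t • u)).hasFDerivAt.comp_hasDerivAt t h1
    have h3 := ((ContinuousMultilinearMap.apply ℝ
      (fun _ : Fin k => EuclideanSpace ℝ (Fin d)) ℝ (fun _ => u)).hasFDerivAt (x :=
        iteratedFDeriv ℝ k f (x + t • u))).comp_hasDerivAt t h2
    rw [iteratedFDeriv_succ_apply_left]
    exact h3
  · intro t
    have := (iteratedFDeriv ℝ r f (x + t • u)).le_opNorm (fun _ => u)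
    simp only [Finset.prod_const, Finset.card_univ, Fintype.card_fin] at this
    exact this.trans (by gcongr; exact hM _)

/-- The smoothing of `f` at scale `h` by the kernel `K`. -/
noncomputable def kernelSmooth (K : EuclideanSpace ℝ (Fin d) → ℝ) (h : ℝ)
    (f : EuclideanSpace ℝ (Fin d) → ℝ)
    (x : EuclideanSpace ℝ (Fin d)) : ℝ := ∫ u, K u * f (x + h • u)

/-- Under the integral the Taylor polynomial of `f` at `x` collapses to its constant term `f x`.
What is left is the remainder, at most `M * ‖h • u‖ ^ r`, integrated against `|K|`. Positivity of
`r` ensures that the constant term is present. -/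
lemma IsExpKernelOfOrder.exists_bias_bound {r : ℕ} (hr : 0 < r) {K : EuclideanSpace ℝ (Fin d) → ℝ}
    (hK : IsExpKernelOfOrder r K) {f : EuclideanSpace ℝ (Fin d) → ℝ} (hf_meas : Measurable f)
    (hf_bdd : ∃ M : ℝ, ∀ x, |f x| ≤ M) (hf : HasBoundedDerivOfOrder r f) :
    ∃ C : ℝ, 0 ≤ C ∧ ∀ h : ℝ, 0 < h → ∀ x, |kernelSmooth K h f x - f x| ≤ C * h ^ r := by
  obtain ⟨M, hM0, hM⟩ := hf.exists_taylor_bound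
  obtain ⟨B, hB⟩ := hf_bdd
  have hKm := hK.measurable
  refine ⟨M * ∫ u, ‖u‖ ^ r * |K u|, mul_nonneg hM0 (integral_nonneg fun u => by positivity),
    fun h hh x => ?_⟩
  have hint : ∀ k : ℕ, Integrable fun u : EuclideanSpace ℝ (Fin d) =>
      K u * iteratedFDeriv ℝ k f x (fun _ => u) := by
    intro k
    have hc : Continuous fun u : EuclideanSpace ℝ (Fin d) =>
        iteratedFDeriv ℝ k f x (fun _ => u) := by fun_prop
    refine ((hK.integrable_norm_pow_mul_abs k).const_mul ‖iteratedFDeriv ℝ k f x‖).mono'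
      (hKm.aestronglyMeasurable.mul hc.aestronglyMeasurable) (ae_of_all _ fun u => ?_)
    rw [norm_mul, Real.norm_eq_abs (K u)]
    have := (iteratedFDeriv ℝ k f x).le_opNorm (fun _ => u)
    simp only [Finset.prod_const, Finset.card_univ, Fintype.card_fin] at this
    calc |K u| * ‖iteratedFDeriv ℝ k f x (fun _ => u)‖
        ≤ |K u| * (‖iteratedFDeriv ℝ k f x‖ * ‖u‖ ^ k) := by gcongr
      _ = _ := by ring
  have hsm : ∀ k (u : EuclideanSpace ℝ (Fin d)), iteratedFDeriv ℝ k f x (fun _ => h • u) =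
      h ^ k * iteratedFDeriv ℝ k f x (fun _ => u) := by
    intro k u
    rw [ContinuousMultilinearMap.map_smul_univ]
    simp
  have hint2 : ∀ k : ℕ, Integrable fun u : EuclideanSpace ℝ (Fin d) =>
      K u * (iteratedFDeriv ℝ k f x (fun _ => h • u) / k.factorial) := by
    intro k
    refine ((hint k).const_mul (h ^ k / k.factorial)).congr (ae_of_all _ fun u => ?_)
    simp only [hsm]
    ring
  have hpoly : ∫ u, K u * ∑ k ∈ Finset.range r,
      iteratedFDeriv ℝ k f x (fun _ => h • u) / k.factorial = f x := by
    simp_rw [Finset.mul_sum]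
    rw [integral_finsetSum _ fun k _ => hint2 k, Finset.sum_eq_single 0]
    · simp [integral_mul_const, hK.integral_eq_one]
    · intro k hk hk0
      have := hK.integral_multilinear_eq_zero (Nat.pos_of_ne_zero hk0) (Finset.mem_range.1 hk)
        (iteratedFDeriv ℝ k f x)
      calc ∫ u, K u * (iteratedFDeriv ℝ k f x (fun _ => h • u) / k.factorial)
          = ∫ u, (h ^ k / k.factorial) * (K u * iteratedFDeriv ℝ k f x (fun _ => u)) := by
            congr 1 with u; rw [hsm]; ring
        _ = 0 := by rw [integral_const_mul, this, mul_zero]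
    · intro h0; exact absurd (Finset.mem_range.2 hr) h0
  have hint3 : Integrable fun u : EuclideanSpace ℝ (Fin d) => K u * f (x + h • u) :=
    hK.integrable_mul_of_bounded (by fun_prop) fun u => hB _
  have hint4 : Integrable fun u : EuclideanSpace ℝ (Fin d) => K u * ∑ k ∈ Finset.range r,
      iteratedFDeriv ℝ k f x (fun _ => h • u) / k.factorial := by
    simp_rw [Finset.mul_sum]
    exact integrable_finsetSum _ fun k _ => hint2 k
  have hsplit : kernelSmooth K h f x - f x = (∫ u, K u * f (x + h • u)) -
      ∫ u, K u * ∑ k ∈ Finset.range r,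
        iteratedFDeriv ℝ k f x (fun _ => h • u) / k.factorial := by
    rw [hpoly, kernelSmooth]
  rw [hsplit]
  rw [← integral_sub hint3 hint4, ← Real.norm_eq_abs]
  calc _ ≤ ∫ u : EuclideanSpace ℝ (Fin d), (M * h ^ r) * (‖u‖ ^ r * |K u|) := by
        refine norm_integral_le_of_norm_le ((hK.integrable_norm_pow_mul_abs r).const_mul _)
          (ae_of_all _ fun u => ?_)
        rw [← mul_sub, norm_mul, Real.norm_eq_abs, Real.norm_eq_abs]
        calc _ ≤ |K u| * (M * ‖h • u‖ ^ r) := by gcongr; exact hM x (h • u)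
          _ = _ := by rw [norm_smul, Real.norm_of_nonneg hh.le, mul_pow]; ring
    _ = _ := by rw [integral_const_mul]; ring

lemma integral_comp_inv_smul_sub {h : ℝ} (hh : 0 < h)
    (G : EuclideanSpace ℝ (Fin d) → EuclideanSpace ℝ (Fin d) → ℝ)
    (x : EuclideanSpace ℝ (Fin d)) :
    ∫ y, (h ^ d)⁻¹ * G (h⁻¹ • (y - x)) y = ∫ u, G u (x + h • u) := by
  have h1 := integral_sub_right_eq_self (μ := (volume : Measure (EuclideanSpace ℝ (Fin d))))
    (fun z => (h ^ d)⁻¹ * G (h⁻¹ • z) (x + z)) x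
  simp only [add_sub_cancel] at h1
  have h2 := Measure.integral_comp_inv_smul (volume : Measure (EuclideanSpace ℝ (Fin d)))
    (fun u => G u (x + h • u)) h
  simp only [smul_inv_smul₀ hh.ne', finrank_euclideanSpace, Fintype.card_fin, smul_eq_mul] at h2
  rw [abs_of_pos (by positivity)] at h2
  rw [h1, integral_const_mul, h2, ← mul_assoc, inv_mul_cancel₀ (by positivity), one_mul]

lemma kernelSmooth_eq {h : ℝ} (hh : 0 < h) (K f : EuclideanSpace ℝ (Fin d) → ℝ)
    (x : EuclideanSpace ℝ (Fin d)) :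
    kernelSmooth K h f x = ∫ y, (h ^ d)⁻¹ * K (h⁻¹ • (y - x)) * f y := by
  rw [kernelSmooth, ← integral_comp_inv_smul_sub hh (fun u y => K u * f y)]
  simp only [mul_assoc]

/-- Continuity of translations in `L¹`. -/
lemma tendsto_integral_abs_comp_add_sub {q : EuclideanSpace ℝ (Fin d) → ℝ} (hq : Integrable q) :
    Tendsto (fun v => ∫ y, |q (y + v) - q y|) (𝓝 0) (𝓝 0) := by
  let g : EuclideanSpace ℝ (Fin d) → C(EuclideanSpace ℝ (Fin d), EuclideanSpace ℝ (Fin d)) :=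
    fun v => ⟨fun y => y + v, by fun_prop⟩
  have hg : Continuous g := ContinuousMap.continuous_of_continuous_uncurry _ (by
    simp only [g, Function.uncurry_def, ContinuousMap.coe_mk]; fun_prop)
  have hgm : ∀ v, MeasurePreserving (g v) volume volume :=
    fun v => measurePreserving_add_right volume v
  have hq1 : MemLp q 1 volume := memLp_one_iff_integrable.2 hq
  have hcont : Continuous fun v => Lp.compMeasurePreserving (g v) (hgm v) (hq1.toLp q) :=
    continuous_const.compMeasurePreservingLp hg hgm (by simp)
  have h1 := (hcont.sub (continuous_const
    (y := Lp.compMeasurePreserving (g 0) (hgm 0) (hq1.toLp q)))).norm.tendsto 0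
  simp only [Pi.sub_apply] at h1
  rw [sub_self, norm_zero] at h1
  refine h1.congr fun v => ?_
  rw [L1.norm_eq_integral_norm]
  refine integral_congr_ae ?_
  have e0 : ∀ v, (Lp.compMeasurePreserving (g v) (hgm v) (hq1.toLp q) : _ → ℝ)
      =ᵐ[volume] fun y => q (y + v) := fun v =>
    (Lp.coeFn_compMeasurePreserving _ (hgm v)).trans
      ((hgm v).quasiMeasurePreserving.ae_eq_comp hq1.coeFn_toLp)
  filter_upwards [Lp.coeFn_sub (Lp.compMeasurePreserving (g v) (hgm v) (hq1.toLp q))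
    (Lp.compMeasurePreserving (g 0) (hgm 0) (hq1.toLp q)), e0 v, e0 0] with y h1 h2 h3
  rw [h1, Pi.sub_apply, h2, h3, add_zero, Real.norm_eq_abs]

/-- By Fubini the `L¹` error is at most the average of the translation modulus `ω (h n • u)` against
`|K|`, and dominated convergence applies. It is used for functions with no smoothness, hence the
absence of a rate. -/
lemma IsExpKernelOfOrder.tendsto_integral_abs_kernelSmooth_sub {r : ℕ}
    {K : EuclideanSpace ℝ (Fin d) → ℝ} (hK : IsExpKernelOfOrder r K)
    {q : EuclideanSpace ℝ (Fin d) → ℝ} (hqm : Measurable q) (hq : Integrable q)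
    (hqb : ∃ M : ℝ, ∀ x, |q x| ≤ M) {h : ℕ → ℝ} (hh : Tendsto h atTop (𝓝 0)) :
    Tendsto (fun n => ∫ y, |kernelSmooth K (h n) q y - q y|) atTop (𝓝 0) := by
  obtain ⟨B, hB⟩ := hqb
  have hKm := hK.measurable
  set ω : EuclideanSpace ℝ (Fin d) → ℝ := fun v => ∫ y, |q (y + v) - q y| with hω
  have hωm : StronglyMeasurable ω := by
    refine StronglyMeasurable.integral_prod_right
      (f := fun (v y : EuclideanSpace ℝ (Fin d)) => |q (y + v) - q y|) ?_
    exact Measurable.stronglyMeasurable (by fun_prop)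
  have hshift : ∀ v, Integrable fun y => q (y + v) := fun v => hq.comp_add_right v
  have hωb : ∀ v, |ω v| ≤ 2 * ∫ y, |q y| := by
    intro v
    rw [abs_of_nonneg (integral_nonneg fun y => abs_nonneg _)]
    calc ω v ≤ ∫ y, (|q (y + v)| + |q y|) :=
          integral_mono ((hshift v).sub hq).abs ((hshift v).abs.add hq.abs) fun y => abs_sub _ _
      _ = _ := by
          rw [integral_add (hshift v).abs hq.abs,
            integral_add_right_eq_self (fun y => |q y|) v]
          ring
  have hdom : Tendsto (fun n => ∫ u, |K u| * ω (h n • u)) atTop (𝓝 0) := by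
    have : (0 : ℝ) = ∫ u : EuclideanSpace ℝ (Fin d), |K u| * 0 := by simp
    rw [this]
    refine tendsto_integral_of_dominated_convergence (fun u => |K u| * (2 * ∫ y, |q y|))
      (fun n => ?_) (hK.integrable.abs.mul_const _) (fun n => ae_of_all _ fun u => ?_)
      (ae_of_all _ fun u => ?_)
    · have := hωm.measurable
      exact Measurable.aestronglyMeasurable (by fun_prop)
    · rw [norm_mul, Real.norm_eq_abs, abs_abs, Real.norm_eq_abs]
      gcongr
      exact hωb _
    · refine Tendsto.const_mul _ ?_
      have h0 : Tendsto (fun n => h n • u) atTop (𝓝 0) := by simpa using hh.smul_const u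
      exact (tendsto_integral_abs_comp_add_sub hq).comp h0
  refine squeeze_zero (fun n => integral_nonneg fun y => abs_nonneg _) (fun n => ?_) hdom
  have hprod : Integrable (fun p : EuclideanSpace ℝ (Fin d) × EuclideanSpace ℝ (Fin d) =>
      |K p.1| * |q (p.2 + h n • p.1) - q p.2|) (volume.prod volume) := by
    rw [integrable_prod_iff (Measurable.aestronglyMeasurable (by fun_prop))]
    refine ⟨ae_of_all _ fun u => (((hshift (h n • u)).sub hq).abs).const_mul |K u|, ?_⟩
    have : (fun u => ∫ y, ‖|K u| * |q (y + h n • u) - q y|‖) = fun u => |K u| * ω (h n • u) := by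
      ext u
      rw [hω]
      simp only [← integral_const_mul]
      congr 1 with y
      rw [Real.norm_of_nonneg (by positivity)]
    simp only [this]
    have := hωm.measurable
    refine hK.integrable.abs.mul_bdd
      (Measurable.aestronglyMeasurable (by fun_prop)) (ae_of_all _ fun u => hωb _)
  calc ∫ y, |kernelSmooth K (h n) q y - q y|
      ≤ ∫ y, ∫ u, |K u| * |q (y + h n • u) - q y| := by
        refine integral_mono_of_nonneg (ae_of_all _ fun y => abs_nonneg _)
          hprod.integral_prod_right (ae_of_all _ fun y => ?_)
        have e1 : kernelSmooth K (h n) q y - q y = ∫ u, K u * (q (y + h n • u) - q y) := by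
          simp_rw [mul_sub]
          rw [integral_sub (hK.integrable_mul_of_bounded (by fun_prop) fun u => hB _)
            (hK.integrable.mul_const _), integral_mul_const, hK.integral_eq_one, one_mul]
          rfl
        beta_reduce
        rw [e1, ← Real.norm_eq_abs]
        refine (norm_integral_le_integral_norm _).trans_eq ?_
        simp only [norm_mul, Real.norm_eq_abs]
    _ = ∫ u, ∫ y, |K u| * |q (y + h n • u) - q y| := (integral_integral_swap hprod).symm
    _ = ∫ u, |K u| * ω (h n • u) := by simp only [hω, integral_const_mul]

end Smoothing

/-! ### Independence, integrating out one variable, degenerate U-statistics. -/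

section Independence

variable {Ω : Type*} [MeasurableSpace Ω] {P : Measure Ω}
  {α β : Type*} [MeasurableSpace α] [MeasurableSpace β]

/-- Measurable rectangles form a generating π-system, and on them the three independence hypotheses
factor the probability. The central limit theorem needs this for functions of the pair of design
point and noise. -/
lemma iIndepFun_prodMk {ι : Type*} {X : ι → Ω → α} {e : ι → Ω → β}
    (hXm : ∀ i, Measurable (X i)) (hem : ∀ i, Measurable (e i))
    (hX : iIndepFun X P) (he : iIndepFun e P)
    (hXe : IndepFun (fun ω i => X i ω) (fun ω i => e i ω) P) :
    iIndepFun (fun i ω => (X i ω, e i ω)) P := by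
  classical
  rw [iIndepFun_iff_iIndep]
  refine iIndepSets.iIndep (fun i => ((hXm i).prodMk (hem i)).comap_le)
    (fun i => {s | ∃ t ∈ Set.image2 (· ×ˢ ·) {A : Set α | MeasurableSet A}
      {B : Set β | MeasurableSet B}, (fun ω => (X i ω, e i ω)) ⁻¹' t = s})
    (fun i => isPiSystem_prod.comap _) (fun i => ?_) ?_
  · rw [← generateFrom_prod, MeasurableSpace.comap_generateFrom]
    rfl
  rw [iIndepSets_iff]
  intro s t ht
  -- Indices outside `s` receive dummy empty sets, so that the choices are defined for every `i`.
  have ht' : ∀ i, ∃ A : Set α, ∃ B : Set β, MeasurableSet A ∧ MeasurableSet B ∧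
      (i ∈ s → t i = X i ⁻¹' A ∩ e i ⁻¹' B) := by
    intro i
    by_cases hi : i ∈ s
    · obtain ⟨_, ⟨A, hA, B, hB, rfl⟩, h⟩ := ht i hi
      exact ⟨A, B, hA, hB, fun _ => h ▸ rfl⟩
    · exact ⟨∅, ∅, MeasurableSet.empty, MeasurableSet.empty, fun h => absurd h hi⟩
  choose A B hA hB hAB using ht'
  have hSA : MeasurableSet (⋂ i ∈ s, (fun x : ι → α => x i) ⁻¹' A i) :=
    Finset.measurableSet_biInter _ fun i _ => measurable_pi_apply i (hA i)
  have hSB : MeasurableSet (⋂ i ∈ s, (fun x : ι → β => x i) ⁻¹' B i) :=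
    Finset.measurableSet_biInter _ fun i _ => measurable_pi_apply i (hB i)
  have h1 : ⋂ i ∈ s, t i = (fun ω i => X i ω) ⁻¹' (⋂ i ∈ s, (fun x : ι → α => x i) ⁻¹' A i) ∩
      (fun ω i => e i ω) ⁻¹' (⋂ i ∈ s, (fun x : ι → β => x i) ⁻¹' B i) := by
    rw [Set.iInter₂_congr hAB]
    ext ω
    simp only [Set.mem_iInter, Set.mem_inter_iff, Set.mem_preimage]
    exact ⟨fun h => ⟨fun i hi => (h i hi).1, fun i hi => (h i hi).2⟩,
      fun h i hi => ⟨h.1 i hi, h.2 i hi⟩⟩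
  have h2 : (fun ω i => X i ω) ⁻¹' (⋂ i ∈ s, (fun x : ι → α => x i) ⁻¹' A i) =
      ⋂ i ∈ s, X i ⁻¹' A i := by ext ω; simp
  have h3 : (fun ω i => e i ω) ⁻¹' (⋂ i ∈ s, (fun x : ι → β => x i) ⁻¹' B i) =
      ⋂ i ∈ s, e i ⁻¹' B i := by ext ω; simp
  rw [h1, hXe.measure_inter_preimage_eq_mul _ _ hSA hSB, h2, h3,
    hX.measure_inter_preimage_eq_mul s fun i _ => hA i,
    he.measure_inter_preimage_eq_mul s fun i _ => hB i, ← Finset.prod_mul_distrib]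
  refine Finset.prod_congr rfl fun i hi => ?_
  rw [hAB i hi]
  refine (IndepFun.measure_inter_preimage_eq_mul ?_ _ _ (hA i) (hB i)).symm
  exact hXe.comp (measurable_pi_apply i) (measurable_pi_apply i)

lemma ProbabilityTheory.IndepFun.integral_eq_integral_integral [IsProbabilityMeasure P]
    {X : Ω → α} {Z : Ω → β}
    (hXm : Measurable X) (hZm : Measurable Z) (hXZ : IndepFun X Z P) {F : α → β → ℝ}
    (hF : Measurable (Function.uncurry F)) {M : ℝ} (hM : ∀ x z, |F x z| ≤ M) :
    ∫ ω, F (X ω) (Z ω) ∂P = ∫ x, ∫ ω, F x (Z ω) ∂P ∂(P.map X) := by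
  have := Measure.isProbabilityMeasure_map (μ := P) hXm.aemeasurable
  have := Measure.isProbabilityMeasure_map (μ := P) hZm.aemeasurable
  calc ∫ ω, F (X ω) (Z ω) ∂P = ∫ p, Function.uncurry F p ∂(P.map fun ω => (X ω, Z ω)) := by
        rw [integral_map (hXm.prodMk hZm).aemeasurable hF.aestronglyMeasurable]
        rfl
    _ = ∫ p, Function.uncurry F p ∂((P.map X).prod (P.map Z)) := by
        rw [hXZ.map_prod_eq_prod_map_map hXm.aemeasurable hZm.aemeasurable]
    _ = ∫ x, ∫ z, F x z ∂(P.map Z) ∂(P.map X) := by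
        refine integral_prod _ (Integrable.of_bound hF.aestronglyMeasurable M
          (ae_of_all _ fun p => hM _ _))
    _ = _ := by
        congr 1 with x
        rw [integral_map hZm.aemeasurable]
        exact (hF.comp measurable_prodMk_left).aestronglyMeasurable

variable {X : ℕ → Ω → α} {μ : Measure α}

lemma integral_comp_two [IsProbabilityMeasure P] (hXm : ∀ i, Measurable (X i)) (hX : iIndepFun X P)
    (hμ : ∀ i, P.map (X i) = μ) {i j : ℕ} (hij : i ≠ j) {F : α → α → ℝ}
    (hF : Measurable (Function.uncurry F)) {M : ℝ} (hM : ∀ x z, |F x z| ≤ M) :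
    ∫ ω, F (X i ω) (X j ω) ∂P = ∫ x, ∫ y, F x y ∂μ ∂μ := by
  rw [(hX.indepFun hij).integral_eq_integral_integral (hXm i) (hXm j) hF hM, hμ i]
  congr 1 with x
  rw [← hμ j, integral_map (hXm j).aemeasurable]
  exact (hF.comp measurable_prodMk_left).aestronglyMeasurable

variable [Inhabited α]

/-- Freezing the coordinates outside `S` at a default value keeps the type `ℕ → α` for every `S`. A
statistic that reads only the coordinates in `S` is unaffected. -/
lemma ProbabilityTheory.iIndepFun.indepFun_ite_mem (hXm : ∀ i, Measurable (X i))
    (hX : iIndepFun X P) {i : ℕ} {S : Finset ℕ} (hi : i ∉ S) :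
    IndepFun (X i) (fun ω j => if j ∈ S then X j ω else default) P := by
  have h := hX.indepFun_finset {i} S (Finset.disjoint_singleton_left.2 hi) hXm
  have h1 : Measurable fun z : ({i} : Finset ℕ) → α => z ⟨i, Finset.mem_singleton_self i⟩ :=
    measurable_pi_apply _
  have h2 : Measurable fun (z : S → α) (j : ℕ) =>
      if hj : j ∈ S then z ⟨j, hj⟩ else (default : α) := by
    refine measurable_pi_lambda _ fun j => ?_
    by_cases hj : j ∈ S
    · simp only [hj, dite_true]; exact measurable_pi_apply _
    · simp only [hj, dite_false]; exact measurable_const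
  have h3 : (fun ω j => if j ∈ S then X j ω else default) =
      (fun (z : S → α) (j : ℕ) => if hj : j ∈ S then z ⟨j, hj⟩ else (default : α)) ∘
        fun ω (i : S) => X i ω := by
    funext ω j
    by_cases hj : j ∈ S <;> simp [hj]
  rw [h3]
  exact h.comp h1 h2

lemma measurable_ite_mem (hXm : ∀ i, Measurable (X i)) (S : Finset ℕ) :
    Measurable fun ω j => if j ∈ S then X j ω else default := by
  refine measurable_pi_lambda _ fun j => ?_
  by_cases hj : j ∈ S
  · simpa only [hj, if_true] using hXm j
  · simp only [hj, if_false]; exact measurable_const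

lemma integral_comp_eq_integral_integral [IsProbabilityMeasure P]
    (hXm : ∀ i, Measurable (X i)) (hX : iIndepFun X P)
    (hμ : ∀ i, P.map (X i) = μ) {i : ℕ} {S : Finset ℕ} (hi : i ∉ S) {F : α → (ℕ → α) → ℝ}
    (hF : Measurable (Function.uncurry F)) {M : ℝ} (hM : ∀ x z, |F x z| ≤ M) :
    ∫ ω, F (X i ω) (fun j => if j ∈ S then X j ω else default) ∂P =
      ∫ x, ∫ ω, F x (fun j => if j ∈ S then X j ω else default) ∂P ∂μ := by
  rw [← hμ i]
  exact (hX.indepFun_ite_mem hXm hi).integral_eq_integral_integral (hXm i)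
    (measurable_ite_mem hXm S) hF hM

lemma integral_comp_eq_zero [IsProbabilityMeasure P]
    [IsProbabilityMeasure μ] (hXm : ∀ i, Measurable (X i))
    (hX : iIndepFun X P)
    (hμ : ∀ i, P.map (X i) = μ) {i : ℕ} {S : Finset ℕ} (hi : i ∉ S) {F : α → (ℕ → α) → ℝ}
    (hF : Measurable (Function.uncurry F)) {M : ℝ} (hM : ∀ x z, |F x z| ≤ M)
    (h0 : ∀ z, ∫ x, F x z ∂μ = 0) :
    ∫ ω, F (X i ω) (fun j => if j ∈ S then X j ω else default) ∂P = 0 := by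
  rw [integral_comp_eq_integral_integral hXm hX hμ hi hF hM, integral_integral_swap]
  · simp only [h0, integral_zero]
  · refine Integrable.of_bound ?_ M (ae_of_all _ fun p => hM _ _)
    have := measurable_ite_mem hXm S
    exact (hF.comp (measurable_fst.prodMk (this.comp measurable_snd))).aestronglyMeasurable

/-- The second moment of a degenerate `U`-statistic of order two. -/
lemma integral_sq_sum_degenerate_le [IsProbabilityMeasure P]
    [IsProbabilityMeasure μ] (hXm : ∀ i, Measurable (X i))
    (hX : iIndepFun X P) (hμ : ∀ i, P.map (X i) = μ) {b : α → α → ℝ}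
    (hb : Measurable (Function.uncurry b)) {M : ℝ} (hM : ∀ x y, |b x y| ≤ M)
    (h1 : ∀ x, ∫ y, b x y ∂μ = 0) (h2 : ∀ y, ∫ x, b x y ∂μ = 0) (n : ℕ) :
    ∫ ω, (∑ i ∈ Finset.range n, ∑ j ∈ (Finset.range n).erase i, b (X i ω) (X j ω)) ^ 2 ∂P ≤
      2 * (n : ℝ) ^ 2 * ∫ x, ∫ y, b x y ^ 2 ∂μ ∂μ := by
  classical
  set β := ∫ x, ∫ y, b x y ^ 2 ∂μ ∂μ with hβ
  have hβ0 : 0 ≤ β := integral_nonneg fun x => integral_nonneg fun y => sq_nonneg _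
  have hM0 : ∀ x y z w, |b x y * b z w| ≤ M * M := by
    intro x y z w
    rw [abs_mul]
    exact mul_le_mul (hM _ _) (hM _ _) (abs_nonneg _) ((abs_nonneg _).trans (hM x y))
  have hbm : ∀ i j, Measurable fun ω => b (X i ω) (X j ω) := fun i j =>
    hb.comp ((hXm i).prodMk (hXm j))
  have hint : ∀ i j k l, Integrable (fun ω => b (X i ω) (X j ω) * b (X k ω) (X l ω)) P :=
    fun i j k l => Integrable.of_bound ((hbm i j).mul (hbm k l)).aestronglyMeasurable (M * M)
      (ae_of_all _ fun ω => hM0 _ _ _ _)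
  have hbz : ∀ k l : ℕ, Measurable fun p : α × (ℕ → α) => b (p.2 k) (p.2 l) := fun k l =>
    hb.comp (by fun_prop : Measurable fun p : α × (ℕ → α) => (p.2 k, p.2 l))
  -- An index that occurs only once among the four can be integrated out alone, and degeneracy gives
  -- zero; `hright` is the same for the second slot.
  have hleft : ∀ i j k l, i ≠ j → i ≠ k → i ≠ l →
      ∫ ω, b (X i ω) (X j ω) * b (X k ω) (X l ω) ∂P = 0 := by
    intro i j k l hj hk hl
    have := integral_comp_eq_zero hXm hX hμ (i := i) (S := {j, k, l}) (by simp [hj, hk, hl])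
      (F := fun x z => b x (z j) * b (z k) (z l))
      ((hb.comp (by fun_prop : Measurable fun p : α × (ℕ → α) => (p.1, p.2 j))).mul (hbz k l))
      (fun x z => hM0 _ _ _ _)
      (fun z => by rw [integral_mul_const, h2, zero_mul])
    simpa using this
  have hright : ∀ i j k l, j ≠ i → j ≠ k → j ≠ l →
      ∫ ω, b (X i ω) (X j ω) * b (X k ω) (X l ω) ∂P = 0 := by
    intro i j k l hi hk hl
    have := integral_comp_eq_zero hXm hX hμ (i := j) (S := {i, k, l}) (by simp [hi, hk, hl])
      (F := fun x z => b (z i) x * b (z k) (z l))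
      ((hb.comp (by fun_prop : Measurable fun p : α × (ℕ → α) => (p.2 i, p.1))).mul (hbz k l))
      (fun x z => hM0 _ _ _ _)
      (fun z => by rw [integral_mul_const, h1, zero_mul])
    simpa using this
  have hsq : ∀ i j, i ≠ j → ∫ ω, b (X i ω) (X j ω) * b (X i ω) (X j ω) ∂P = β := by
    intro i j hij
    rw [hβ]
    simp only [← pow_two]
    refine integral_comp_two hXm hX hμ hij (F := fun x y => b x y ^ 2) (hb.pow_const 2)
      (M := M * M) fun x y => ?_
    rw [pow_two]; exact hM0 _ _ _ _
  -- Only the pairs `(i, j)` and `(j, i)` survive. The first contributes `β`, the second at most `β`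
  -- by the arithmetic-geometric mean inequality; this is the factor 2 in the bound.
  have hpair : ∀ i j k l, i ≠ j → k ≠ l →
      ∫ ω, b (X i ω) (X j ω) * b (X k ω) (X l ω) ∂P ≤
        (if k = i ∧ l = j then β else 0) + (if k = j ∧ l = i then β else 0) := by
    intro i j k l hij hkl
    by_cases hi : i = k ∨ i = l
    · by_cases hj : j = k ∨ j = l
      · rcases hi with rfl | rfl <;> rcases hj with rfl | rfl
        · exact absurd rfl hij
        · rw [hsq _ _ hij]; simp [hij]
        · simp only [hij.symm, false_and, if_false, and_self, if_true, zero_add]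
          calc ∫ ω, b (X i ω) (X j ω) * b (X j ω) (X i ω) ∂P
              ≤ ∫ ω, (2⁻¹ * (b (X i ω) (X j ω) * b (X i ω) (X j ω)) +
                  2⁻¹ * (b (X j ω) (X i ω) * b (X j ω) (X i ω))) ∂P := by
                refine integral_mono (hint _ _ _ _)
                  (((hint _ _ _ _).const_mul _).add ((hint _ _ _ _).const_mul _)) fun ω => ?_
                beta_reduce
                nlinarith [sq_nonneg (b (X i ω) (X j ω) - b (X j ω) (X i ω))]
            _ = β := by
                rw [integral_add ((hint _ _ _ _).const_mul _) ((hint _ _ _ _).const_mul _),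
                  integral_const_mul, integral_const_mul, hsq _ _ hij, hsq _ _ hij.symm]
                ring
        · exact absurd rfl hij
      · push Not at hj
        rw [hright i j k l hij.symm hj.1 hj.2]
        positivity
    · push Not at hi
      rw [hleft i j k l hij hi.1 hi.2]
      positivity
  have hexp : ∀ ω, (∑ i ∈ Finset.range n, ∑ j ∈ (Finset.range n).erase i,
      b (X i ω) (X j ω)) ^ 2 =
      ∑ i ∈ Finset.range n, ∑ j ∈ (Finset.range n).erase i, ∑ k ∈ Finset.range n,
        ∑ l ∈ (Finset.range n).erase k, b (X i ω) (X j ω) * b (X k ω) (X l ω) := by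
    intro ω
    rw [pow_two, Finset.sum_mul]
    refine Finset.sum_congr rfl fun i _ => ?_
    rw [Finset.sum_mul]
    refine Finset.sum_congr rfl fun j _ => ?_
    rw [Finset.mul_sum]
    exact Finset.sum_congr rfl fun k _ => Finset.mul_sum _ _ _
  simp only [hexp]
  rw [integral_finsetSum _ fun i _ => integrable_finsetSum _ fun j _ =>
    integrable_finsetSum _ fun k _ => integrable_finsetSum _ fun l _ => hint i j k l]
  calc _ ≤ ∑ i ∈ Finset.range n, ∑ j ∈ Finset.range n, 2 * β := by
        refine Finset.sum_le_sum fun i hi => ?_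
        rw [integral_finsetSum _ fun j _ =>
          integrable_finsetSum _ fun k _ => integrable_finsetSum _ fun l _ => hint i j k l]
        refine (Finset.sum_le_sum (g := fun _ => 2 * β) fun j hj => ?_).trans
          (Finset.sum_le_sum_of_subset_of_nonneg (Finset.erase_subset _ _)
            fun _ _ _ => by positivity)
        rw [Finset.mem_erase] at hj
        rw [integral_finsetSum _ fun k _ => integrable_finsetSum _ fun l _ => hint i j k l]
        calc _ ≤ ∑ k ∈ Finset.range n, ∑ l ∈ Finset.range n,
              ((if k = i ∧ l = j then β else 0) + (if k = j ∧ l = i then β else 0)) := by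
              refine Finset.sum_le_sum fun k hk => ?_
              rw [integral_finsetSum _ fun l _ => hint i j k l]
              refine (Finset.sum_le_sum fun l hl =>
                hpair i j k l hj.1.symm (Finset.ne_of_mem_erase hl).symm).trans
                (Finset.sum_le_sum_of_subset_of_nonneg (Finset.erase_subset _ _)
                  fun _ _ _ => by positivity)
          _ = 2 * β := by
              simp only [Finset.sum_add_distrib, ite_and]
              simp only [Finset.sum_ite_irrel, Finset.sum_ite_eq', Finset.sum_const_zero, hi,
                hj.2, if_true]
              ring
    _ = _ := by simp; ring

end Independence

/-! ### Hoeffding decomposition of a bounded kernel. -/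

section Projection

variable {α : Type*} [MeasurableSpace α] {μ : Measure α} [IsProbabilityMeasure μ]

lemma integral_sub_integral_sq_le {D : α → ℝ} (hD : Measurable D) :
    ∫ x, (D x - ∫ y, D y ∂μ) ^ 2 ∂μ ≤ ∫ x, D x ^ 2 ∂μ := by
  rw [← variance_eq_integral hD.aemeasurable]
  exact variance_le_expectation_sq hD.aestronglyMeasurable

/-- The completely degenerate part of `a`. -/
noncomputable def hoeffdingResidual (μ : Measure α) (a : α → α → ℝ) (x y : α) : ℝ :=
  a x y - (∫ y, a x y ∂μ) - (∫ x, a x y ∂μ) + ∫ x, ∫ y, a x y ∂μ ∂μ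

lemma abs_integral_le_of_abs_le {D : α → ℝ} {M : ℝ} (hM : ∀ x, |D x| ≤ M) :
    |∫ x, D x ∂μ| ≤ M := by
  have := norm_integral_le_of_norm_le_const (μ := μ) (f := D) (C := M) (ae_of_all _ hM)
  simpa using this

lemma integrable_of_abs_le {D : α → ℝ} (hD : Measurable D) {M : ℝ} (hM : ∀ x, |D x| ≤ M) :
    Integrable D μ :=
  Integrable.of_bound hD.aestronglyMeasurable M (ae_of_all _ hM)

variable {a : α → α → ℝ} {M : ℝ}

lemma measurable_integral_left (ha : Measurable (Function.uncurry a)) :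
    Measurable fun y => ∫ x, a x y ∂μ :=
  (StronglyMeasurable.integral_prod_left (f := a) ha.stronglyMeasurable).measurable

lemma measurable_integral_right (ha : Measurable (Function.uncurry a)) :
    Measurable fun x => ∫ y, a x y ∂μ :=
  (StronglyMeasurable.integral_prod_right (f := a) ha.stronglyMeasurable).measurable

lemma integral_integral_swap_of_abs_le (ha : Measurable (Function.uncurry a))
    (hM : ∀ x y, |a x y| ≤ M) :
    ∫ x, ∫ y, a x y ∂μ ∂μ = ∫ y, ∫ x, a x y ∂μ ∂μ :=
  integral_integral_swap (integrable_of_abs_le ha fun _ => hM _ _)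

lemma measurable_hoeffdingResidual (ha : Measurable (Function.uncurry a)) :
    Measurable (Function.uncurry (hoeffdingResidual μ a)) :=
  ((ha.sub ((measurable_integral_right ha).comp measurable_fst)).sub
    ((measurable_integral_left ha).comp measurable_snd)).add_const _

lemma abs_hoeffdingResidual_le (hM : ∀ x y, |a x y| ≤ M) (x y : α) :
    |hoeffdingResidual μ a x y| ≤ 4 * M := by
  have h0 := abs_le.1 (hM x y)
  have h1 := abs_le.1 (abs_integral_le_of_abs_le (μ := μ) (hM x))
  have h2 := abs_le.1 (abs_integral_le_of_abs_le (μ := μ) (fun x => hM x y))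
  have h3 := abs_le.1 (abs_integral_le_of_abs_le (μ := μ)
    (fun x => abs_integral_le_of_abs_le (μ := μ) (hM x)))
  rw [hoeffdingResidual, abs_le]
  constructor <;> linarith [h0.1, h0.2, h1.1, h1.2, h2.1, h2.2, h3.1, h3.2]

lemma integral_hoeffdingResidual_right (ha : Measurable (Function.uncurry a))
    (hM : ∀ x y, |a x y| ≤ M) (x : α) : ∫ y, hoeffdingResidual μ a x y ∂μ = 0 := by
  have i1 : Integrable (fun y => a x y) μ :=
    integrable_of_abs_le (ha.comp measurable_prodMk_left) (hM x)
  have i2 : Integrable (fun y => ∫ x, a x y ∂μ) μ :=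
    integrable_of_abs_le (measurable_integral_left ha)
      fun y => abs_integral_le_of_abs_le fun x => hM x y
  simp only [hoeffdingResidual]
  have i3 : Integrable (fun y => a x y - ∫ y, a x y ∂μ) μ := i1.sub (integrable_const _)
  have i4 : Integrable (fun y => a x y - (∫ y, a x y ∂μ) - ∫ x, a x y ∂μ) μ := i3.sub i2
  rw [integral_add i4 (integrable_const _), integral_sub i3 i2, integral_sub i1
    (integrable_const _), integral_integral_swap_of_abs_le ha hM]
  simp

lemma integral_hoeffdingResidual_left (ha : Measurable (Function.uncurry a))
    (hM : ∀ x y, |a x y| ≤ M) (y : α) : ∫ x, hoeffdingResidual μ a x y ∂μ = 0 := by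
  have i1 : Integrable (fun x => a x y) μ :=
    integrable_of_abs_le (ha.comp measurable_prodMk_right) (fun x => hM x y)
  have i2 : Integrable (fun x => ∫ y, a x y ∂μ) μ :=
    integrable_of_abs_le (measurable_integral_right ha)
      fun x => abs_integral_le_of_abs_le (hM x)
  simp only [hoeffdingResidual]
  have i3 : Integrable (fun x => a x y - ∫ y, a x y ∂μ) μ := i1.sub i2
  have i4 : Integrable (fun x => a x y - (∫ y, a x y ∂μ) - ∫ x, a x y ∂μ) μ :=
    i3.sub (integrable_const _)
  rw [integral_add i4 (integrable_const _), integral_sub i3 (integrable_const _),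
    integral_sub i1 i2]
  simp

/-- The residual arises by centring in the first variable and then in the second. Each centring can
only decrease the second moment, a variance being at most a second moment. -/
lemma integral_hoeffdingResidual_sq_le (ha : Measurable (Function.uncurry a))
    (hM : ∀ x y, |a x y| ≤ M) :
    ∫ x, ∫ y, hoeffdingResidual μ a x y ^ 2 ∂μ ∂μ ≤ ∫ x, ∫ y, a x y ^ 2 ∂μ ∂μ := by
  have hA2m := measurable_integral_left (μ := μ) ha
  have hA2 : ∀ y, |∫ x, a x y ∂μ| ≤ M := fun y => abs_integral_le_of_abs_le fun x => hM x y
  set c : α → α → ℝ := fun x y => a x y - ∫ x, a x y ∂μ with hc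
  have hcm : Measurable (Function.uncurry c) := ha.sub (hA2m.comp measurable_snd)
  have hcM : ∀ x y, |c x y| ≤ 2 * M := fun x y =>
    (abs_sub _ _).trans (by linarith [hM x y, hA2 y])
  have hsq : ∀ {t N : ℝ}, |t| ≤ N → |t ^ 2| ≤ N ^ 2 := fun {t N} ht => by
    rw [abs_pow]; exact pow_le_pow_left₀ (abs_nonneg _) ht 2
  have hres : ∀ x y, hoeffdingResidual μ a x y = c x y - ∫ y, c x y ∂μ := by
    intro x y
    simp only [hc]
    have i1 : Integrable (fun y => a x y) μ :=
      integrable_of_abs_le (ha.comp measurable_prodMk_left) (hM x)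
    rw [integral_sub i1 (integrable_of_abs_le hA2m hA2), ← integral_integral_swap_of_abs_le ha hM,
      hoeffdingResidual]
    ring
  have hcm2 : Measurable (Function.uncurry fun x y => c x y ^ 2) := hcm.pow_const 2
  have ham2 : Measurable (Function.uncurry fun x y => a x y ^ 2) := ha.pow_const 2
  calc ∫ x, ∫ y, hoeffdingResidual μ a x y ^ 2 ∂μ ∂μ ≤ ∫ x, ∫ y, c x y ^ 2 ∂μ ∂μ := by
        refine integral_mono_of_nonneg (ae_of_all _ fun x => integral_nonneg fun y => sq_nonneg _)
          (integrable_of_abs_le (measurable_integral_right hcm2)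
            fun x => abs_integral_le_of_abs_le fun y => hsq (hcM x y)) (ae_of_all _ fun x => ?_)
        simp only [hres]
        exact integral_sub_integral_sq_le (hcm.comp measurable_prodMk_left)
    _ = ∫ y, ∫ x, c x y ^ 2 ∂μ ∂μ :=
        integral_integral_swap_of_abs_le hcm2 fun x y => hsq (hcM x y)
    _ ≤ ∫ y, ∫ x, a x y ^ 2 ∂μ ∂μ := by
        refine integral_mono_of_nonneg (ae_of_all _ fun x => integral_nonneg fun y => sq_nonneg _)
          (integrable_of_abs_le (measurable_integral_left ham2)
            fun y => abs_integral_le_of_abs_le fun x => hsq (hM x y)) (ae_of_all _ fun y => ?_)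
        exact integral_sub_integral_sq_le (ha.comp measurable_prodMk_right)
    _ = _ := (integral_integral_swap_of_abs_le ham2 fun x y => hsq (hM x y)).symm

end Projection

/-! ### Moments, Bernstein bounds and convergence in probability for sums. -/

section Sums

variable {Ω : Type*} [MeasurableSpace Ω] {P : Measure Ω}
  {α : Type*} [MeasurableSpace α] {X : ℕ → Ω → α} {μ : Measure α}

lemma integral_comp_of_map_eq (hXm : ∀ i, Measurable (X i)) (hμ : ∀ i, P.map (X i) = μ)
    {D : α → ℝ} (hD : Measurable D) (i : ℕ) : ∫ ω, D (X i ω) ∂P = ∫ x, D x ∂μ := by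
  rw [← hμ i, integral_map (hXm i).aemeasurable hD.aestronglyMeasurable]

lemma integral_sq_sum_sub_le [IsProbabilityMeasure P]
    [IsProbabilityMeasure μ] (hXm : ∀ i, Measurable (X i))
    (hX : iIndepFun X P) (hμ : ∀ i, P.map (X i) = μ) {D : α → ℝ} (hD : Measurable D) {M : ℝ}
    (hM : ∀ x, |D x| ≤ M) (S : Finset ℕ) :
    ∫ ω, (∑ i ∈ S, D (X i ω) - S.card * ∫ x, D x ∂μ) ^ 2 ∂P ≤ S.card * ∫ x, D x ^ 2 ∂μ := by
  have hDX : ∀ i, Measurable fun ω => D (X i ω) := fun i => hD.comp (hXm i)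
  have hmem : ∀ i, MemLp (fun ω => D (X i ω)) 2 P := fun i =>
    MemLp.of_bound (hDX i).aestronglyMeasurable M (ae_of_all _ fun ω => hM _)
  have h1 := IndepFun.variance_sum (μ := P) (X := fun i ω => D (X i ω)) (s := S)
    (fun i _ => hmem i) (fun i _ j _ hij => (hX.indepFun hij).comp hD hD)
  have h2 : ∀ i, Var[fun ω => D (X i ω); P] ≤ ∫ x, D x ^ 2 ∂μ := fun i => by
    rw [← integral_comp_of_map_eq hXm hμ (hD.pow_const 2) i]
    exact variance_le_expectation_sq (hDX i).aestronglyMeasurable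
  have h3 : ∫ ω, (∑ i ∈ S, fun ω => D (X i ω)) ω ∂P = S.card * ∫ x, D x ∂μ := by
    simp only [Finset.sum_apply]
    rw [integral_finsetSum _ fun i _ => (hmem i).integrable (by norm_num)]
    simp only [integral_comp_of_map_eq hXm hμ hD, Finset.sum_const, nsmul_eq_mul]
  have hsm : Measurable (∑ i ∈ S, fun ω => D (X i ω)) := by
    convert Finset.measurable_sum S fun i _ => hDX i using 1
    ext ω
    simp
  rw [variance_eq_integral hsm.aemeasurable, h3] at h1
  simp only [Finset.sum_apply] at h1
  rw [h1]
  calc _ ≤ ∑ i ∈ S, ∫ x, D x ^ 2 ∂μ := Finset.sum_le_sum fun i _ => h2 i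
    _ = _ := by simp

/-- A one-sided Bernstein inequality. -/
lemma measureReal_sum_le_le_exp [IsProbabilityMeasure P]
    [IsProbabilityMeasure μ] (hXm : ∀ i, Measurable (X i))
    (hX : iIndepFun X P) (hμ : ∀ i, P.map (X i) = μ) {k : α → ℝ} (hk : Measurable k) {B l : ℝ}
    (hB : ∀ x, |k x| ≤ B) (hl : 0 ≤ l) (hlB : l * B ≤ 1) (S : Finset ℕ) (t : ℝ) :
    P.real {ω | ∑ i ∈ S, k (X i ω) ≤ t} ≤
      Real.exp (l * t + S.card * (-l * ∫ x, k x ∂μ + l ^ 2 * ∫ x, k x ^ 2 ∂μ)) := by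
  have hkX : ∀ i, Measurable fun ω => k (X i ω) := fun i => hk.comp (hXm i)
  have habs : ∀ x, |-l * k x| ≤ 1 := fun x => by
    rw [abs_mul, abs_neg, abs_of_nonneg hl]
    exact (mul_le_mul_of_nonneg_left (hB x) hl).trans hlB
  have hksq : Integrable (fun x => k x ^ 2) μ :=
    integrable_of_abs_le (hk.pow_const 2) (M := B ^ 2) fun x => by
      rw [abs_pow]; exact pow_le_pow_left₀ (abs_nonneg _) (hB x) 2
  have hkint : Integrable k μ := integrable_of_abs_le hk hB
  have hmgf : ∀ i, mgf (fun ω => k (X i ω)) P (-l) ≤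
      Real.exp (-l * ∫ x, k x ∂μ + l ^ 2 * ∫ x, k x ^ 2 ∂μ) := by
    intro i
    have h1 : mgf (fun ω => k (X i ω)) P (-l) = ∫ x, Real.exp (-l * k x) ∂μ :=
      integral_comp_of_map_eq hXm hμ (D := fun x => Real.exp (-l * k x)) (by fun_prop) i
    rw [h1]
    -- `exp t ≤ 1 + t + t ^ 2` for `|t| ≤ 1`, which is where `l * B ≤ 1` enters.
    have h2 : ∫ x, Real.exp (-l * k x) ∂μ ≤ ∫ x, (1 + -l * k x + l ^ 2 * k x ^ 2) ∂μ := by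
      refine integral_mono (integrable_of_abs_le (by fun_prop) (M := Real.exp 1) fun x => ?_)
        (((integrable_const _).add (hkint.const_mul _)).add (hksq.const_mul _)) fun x => ?_
      · rw [Real.abs_exp]
        exact Real.exp_le_exp.2 ((le_abs_self _).trans (habs x))
      · have := (abs_le.1 (Real.abs_exp_sub_one_sub_id_le (habs x))).2
        beta_reduce
        nlinarith
    have h3 : ∫ x, (1 + -l * k x + l ^ 2 * k x ^ 2) ∂μ =
        1 + (-l * ∫ x, k x ∂μ + l ^ 2 * ∫ x, k x ^ 2 ∂μ) := by
      have i1 : Integrable (fun x => 1 + -l * k x) μ :=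
        (integrable_const _).add (hkint.const_mul _)
      rw [integral_add i1 (hksq.const_mul _),
        integral_add (integrable_const _) (hkint.const_mul _), integral_const_mul,
        integral_const_mul]
      simp [add_assoc]
    rw [h3, add_comm] at h2
    exact h2.trans (Real.add_one_le_exp _)
  have hind : iIndepFun (fun i ω => k (X i ω)) P := hX.comp (fun _ => k) fun _ => hk
  have h4 := measure_le_le_exp_mul_mgf (μ := P) (X := ∑ i ∈ S, fun ω => k (X i ω)) (t := -l) t
    (by linarith) (by
      have hm : Measurable (∑ i ∈ S, fun ω => k (X i ω)) := by
        convert Finset.measurable_sum S fun i _ => hkX i using 1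
        ext ω
        simp
      refine integrable_of_abs_le (by fun_prop) (M := Real.exp S.card) fun ω => ?_
      rw [Real.abs_exp, Finset.sum_apply, Finset.mul_sum]
      refine Real.exp_le_exp.2 ?_
      calc ∑ i ∈ S, -l * k (X i ω) ≤ ∑ i ∈ S, (1 : ℝ) :=
            Finset.sum_le_sum fun i _ => (le_abs_self _).trans (habs _)
        _ = S.card := by simp)
  rw [hind.mgf_sum hkX] at h4
  simp only [Finset.sum_apply] at h4
  refine h4.trans ?_
  rw [Real.exp_add, neg_neg]
  gcongr
  calc ∏ i ∈ S, mgf (fun ω => k (X i ω)) P (-l)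
      ≤ ∏ i ∈ S, Real.exp (-l * ∫ x, k x ∂μ + l ^ 2 * ∫ x, k x ^ 2 ∂μ) :=
        Finset.prod_le_prod (fun i _ => mgf_nonneg) fun i _ => hmgf i
    _ = _ := by rw [Finset.prod_const, ← Real.exp_nat_mul]

/-- The weights may depend on the whole design, as leave-one-out weights do. Cross terms still
vanish, because the noise is independent of the design and its terms are centred and independent of
each other. -/
lemma integral_sq_sum_mul_noise {e : ℕ → Ω → ℝ} (hXm : ∀ i, Measurable (X i))
    (hem : ∀ i, Measurable (e i)) (he : iIndepFun e P)
    (hXe : IndepFun (fun ω i => X i ω) (fun ω i => e i ω) P)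
    (he2 : ∀ i, MemLp (e i) 2 P) (he0 : ∀ i, ∫ ω, e i ω ∂P = 0) {v : ℝ}
    (hv : ∀ i, ∫ ω, e i ω ^ 2 ∂P = v) {m : ℕ → (ℕ → α) → ℝ} (hm : ∀ i, Measurable (m i)) {M : ℝ}
    (hM : ∀ i z, |m i z| ≤ M) (S : Finset ℕ) :
    ∫ ω, (∑ i ∈ S, m i (fun j => X j ω) * e i ω) ^ 2 ∂P =
      v * ∑ i ∈ S, ∫ ω, m i (fun j => X j ω) ^ 2 ∂P := by
  have hXm' : Measurable fun ω j => X j ω := measurable_pi_lambda _ hXm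
  have hmm : ∀ i, Measurable fun ω => m i (fun j => X j ω) := fun i => (hm i).comp hXm'
  have hint2 : ∀ i, MemLp (fun ω => m i (fun j => X j ω) * e i ω) 2 P := fun i => by
    refine (he2 i).of_le_mul (c := M) ((hmm i).mul (hem i)).aestronglyMeasurable
      (ae_of_all _ fun ω => ?_)
    rw [norm_mul]
    gcongr
    exact hM _ _
  have hprod : ∀ i j, ∫ ω, (m i (fun j => X j ω) * e i ω) * (m j (fun j => X j ω) * e j ω) ∂P =
      (∫ ω, m i (fun j => X j ω) * m j (fun j => X j ω) ∂P) * ∫ ω, e i ω * e j ω ∂P := by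
    intro i j
    have := (hXe.comp ((hm i).mul (hm j))
      ((measurable_pi_apply i).mul (measurable_pi_apply j) :
        Measurable fun z : ℕ → ℝ => z i * z j)).integral_fun_mul_eq_mul_integral
      ((((hm i).mul (hm j)).comp hXm').aestronglyMeasurable)
      (((hem i).mul (hem j)).aestronglyMeasurable)
    refine Eq.trans ?_ this
    congr 1 with ω
    simp only [Function.comp_apply, Pi.mul_apply]
    ring
  have hee : ∀ i j, i ≠ j → ∫ ω, e i ω * e j ω ∂P = 0 := by
    intro i j hij
    rw [(he.indepFun hij).integral_fun_mul_eq_mul_integral (hem i).aestronglyMeasurable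
      (hem j).aestronglyMeasurable, he0, zero_mul]
  have hexp : ∀ ω, (∑ i ∈ S, m i (fun j => X j ω) * e i ω) ^ 2 = ∑ i ∈ S, ∑ j ∈ S,
      (m i (fun j => X j ω) * e i ω) * (m j (fun j => X j ω) * e j ω) := fun ω => by
    rw [pow_two, Finset.sum_mul_sum]
  have hI : ∀ i j, Integrable (fun ω =>
      (m i (fun j => X j ω) * e i ω) * (m j (fun j => X j ω) * e j ω)) P :=
    fun i j => (hint2 i).integrable_mul (hint2 j)
  simp only [hexp]
  rw [integral_finsetSum _ fun i _ => integrable_finsetSum _ fun j _ => hI i j, Finset.mul_sum]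
  refine Finset.sum_congr rfl fun i hi => ?_
  rw [integral_finsetSum _ fun j _ => hI i j, Finset.sum_eq_single i]
  · rw [hprod]
    simp only [← pow_two]
    rw [hv, mul_comm]
  · intro j _ hji
    rw [hprod, hee i j hji.symm, mul_zero]
  · exact fun h => absurd hi h

lemma integral_abs_le_sqrt_of_integral_sq_le [IsProbabilityMeasure P]
    {V : Ω → ℝ} (hV : MemLp V 2 P) {c : ℝ}
    (h : ∫ ω, V ω ^ 2 ∂P ≤ c) : ∫ ω, |V ω| ∂P ≤ √c := by
  refine Real.le_sqrt_of_sq_le (le_trans ?_ h)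
  have h1 := variance_nonneg |V| P
  rw [variance_eq_sub hV.abs] at h1
  simp only [Pi.pow_apply, Pi.abs_apply, sq_abs] at h1
  linarith

/-- Markov's inequality off the exceptional sets. In the application those are the events on which
some relevant density estimate is too small to divide by. -/
lemma tendstoInMeasure_zero_of_abs_le_off [IsProbabilityMeasure P]
    {D D' : ℕ → Ω → ℝ} {B : ℕ → Set Ω}
    (hB : Tendsto (fun n => P.real (B n)) atTop (𝓝 0))
    (hle : ∀ᶠ n in atTop, ∀ ω ∉ B n, |D n ω| ≤ D' n ω) (hD' : ∀ n ω, 0 ≤ D' n ω)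
    (hint : ∀ n, Integrable (D' n) P)
    (hlim : Tendsto (fun n => ∫ ω, D' n ω ∂P) atTop (𝓝 0)) :
    TendstoInMeasure P D atTop 0 := by
  rw [tendstoInMeasure_iff_measureReal_norm]
  intro ε hε
  have h1 : Tendsto (fun n => P.real (B n) + (∫ ω, D' n ω ∂P) / ε) atTop (𝓝 0) := by
    simpa using hB.add (hlim.div_const ε)
  refine squeeze_zero' (Eventually.of_forall fun n => measureReal_nonneg) ?_ h1
  filter_upwards [hle] with n hn
  have hsub : {ω | ε ≤ ‖D n ω - (0 : ℕ → Ω → ℝ) n ω‖} ⊆ B n ∪ {ω | ε ≤ D' n ω} := by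
    intro ω hω
    by_cases hωB : ω ∈ B n
    · exact Or.inl hωB
    · refine Or.inr (le_trans ?_ (hn ω hωB))
      simpa using hω
  have hmarkov : P.real {ω | ε ≤ D' n ω} ≤ (∫ ω, D' n ω ∂P) / ε := by
    rw [le_div_iff₀ hε, mul_comm]
    exact mul_meas_ge_le_integral_of_nonneg (ae_of_all _ (hD' n)) (hint n) ε
  calc _ ≤ P.real (B n ∪ {ω | ε ≤ D' n ω}) := measureReal_mono hsub
    _ ≤ P.real (B n) + P.real {ω | ε ≤ D' n ω} := measureReal_union_le _ _
    _ ≤ _ := by gcongr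

end Sums

/-! ### The leave-one-out density estimate: mean square error and lower deviations. -/

section KernelEstimate

/-- `X` is an i.i.d. sequence with density `f`, and `f` is bounded by `M`. -/
structure IsBoundedDensitySample {Ω : Type*} [MeasurableSpace Ω] {d : ℕ} (P : Measure Ω)
    (X : ℕ → Ω → EuclideanSpace ℝ (Fin d)) (f : EuclideanSpace ℝ (Fin d) → ℝ) (M : ℝ) :
    Prop where
  measurable : ∀ i, Measurable (X i)
  indep : iIndepFun X P
  map_eq : ∀ i, P.map (X i) = volume.withDensity fun x => ENNReal.ofReal (f x)
  measurable_density : Measurable f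
  nonneg : ∀ x, 0 ≤ f x
  le : ∀ x, f x ≤ M

variable {Ω : Type*} [MeasurableSpace Ω] {P : Measure Ω} {d r : ℕ}
  {X : ℕ → Ω → EuclideanSpace ℝ (Fin d)} {f K : EuclideanSpace ℝ (Fin d) → ℝ} {M : ℝ}

lemma integral_withDensity_ofReal (hf : Measurable f) (hf0 : ∀ x, 0 ≤ f x)
    (G : EuclideanSpace ℝ (Fin d) → ℝ) :
    ∫ x, G x ∂(volume.withDensity fun x => ENNReal.ofReal (f x)) = ∫ x, G x * f x := by
  rw [integral_withDensity_eq_integral_toReal_smul hf.ennreal_ofReal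
    (ae_of_all _ fun x => ENNReal.ofReal_lt_top)]
  congr 1 with x
  rw [ENNReal.toReal_ofReal (hf0 x), smul_eq_mul, mul_comm]

lemma IsExpKernelOfOrder.abs_kernelSmooth_le (hK : IsExpKernelOfOrder r K)
    {g : EuclideanSpace ℝ (Fin d) → ℝ} {B : ℝ} (hB : ∀ x, |g x| ≤ B) (h : ℝ)
    (x : EuclideanSpace ℝ (Fin d)) : |kernelSmooth K h g x| ≤ (∫ u, |K u|) * B := by
  rw [kernelSmooth, ← integral_mul_const, ← Real.norm_eq_abs]
  refine norm_integral_le_of_norm_le (hK.integrable.abs.mul_const _) (ae_of_all _ fun u => ?_)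
  rw [norm_mul, Real.norm_eq_abs, Real.norm_eq_abs]
  gcongr
  exact hB _

namespace IsBoundedDensitySample

lemma abs_density_le (hX : IsBoundedDensitySample P X f M) (x : EuclideanSpace ℝ (Fin d)) :
    |f x| ≤ M := by
  rw [abs_of_nonneg (hX.nonneg x)]; exact hX.le x

lemma isProbabilityMeasure [IsProbabilityMeasure P] (hX : IsBoundedDensitySample P X f M) :
    IsProbabilityMeasure (volume.withDensity fun x => ENNReal.ofReal (f x)) :=
  hX.map_eq 0 ▸ Measure.isProbabilityMeasure_map (hX.measurable 0).aemeasurable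

lemma integral_kernel (hX : IsBoundedDensitySample P X f M) {h : ℝ} (hh : 0 < h)
    (x : EuclideanSpace ℝ (Fin d)) :
    ∫ y, K (h⁻¹ • (y - x)) ∂(volume.withDensity fun x => ENNReal.ofReal (f x)) =
      h ^ d * kernelSmooth K h f x := by
  rw [integral_withDensity_ofReal hX.measurable_density hX.nonneg, kernelSmooth_eq hh,
    ← integral_const_mul]
  congr 1 with y
  have : h ^ d ≠ 0 := by positivity
  field_simp

lemma integral_kernel_sq_le (hX : IsBoundedDensitySample P X f M) (hK : IsExpKernelOfOrder r K)
    {h : ℝ} (hh : 0 < h) (x : EuclideanSpace ℝ (Fin d)) :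
    ∫ y, K (h⁻¹ • (y - x)) ^ 2 ∂(volume.withDensity fun x => ENNReal.ofReal (f x)) ≤
      h ^ d * ((∫ u, K u ^ 2) * M) := by
  obtain ⟨C, hC, hCK⟩ := hK.exists_bound
  have hint : Integrable fun u => K u ^ 2 := by
    simp only [pow_two]
    exact hK.integrable_mul_of_bounded hK.measurable hCK
  have h1 := integral_comp_inv_smul_sub hh (fun u y => K u ^ 2 * f y) x
  rw [integral_const_mul] at h1
  rw [integral_withDensity_ofReal hX.measurable_density hX.nonneg]
  have h2 : ∫ y, K (h⁻¹ • (y - x)) ^ 2 * f y = h ^ d * ∫ u, K u ^ 2 * f (x + h • u) := by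
    rw [← h1, ← mul_assoc, mul_inv_cancel₀ (by positivity), one_mul]
  rw [h2, ← integral_mul_const]
  refine mul_le_mul_of_nonneg_left ?_ (by positivity)
  refine integral_mono_of_nonneg (ae_of_all _ fun u => mul_nonneg (sq_nonneg _) (hX.nonneg _))
    (hint.mul_const _) (ae_of_all _ fun u => ?_)
  beta_reduce
  gcongr
  exact hX.le _

end IsBoundedDensitySample

lemma measurable_looKDE (hK : Measurable K) (h : ℝ) (n i : ℕ) :
    Measurable fun p : EuclideanSpace ℝ (Fin d) × (ℕ → EuclideanSpace ℝ (Fin d)) =>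
      looKDE K h n p.2 i p.1 := by
  unfold looKDE
  refine Measurable.const_mul (Finset.measurable_sum _ fun j _ => hK.comp ?_) _
  fun_prop

lemma measurable_looKDE_self (hK : Measurable K) (h : ℝ) (n i : ℕ) :
    Measurable fun z : ℕ → EuclideanSpace ℝ (Fin d) => looKDE K h n z i (z i) := by
  unfold looKDE
  refine Measurable.const_mul (Finset.measurable_sum _ fun j _ => hK.comp ?_) _
  fun_prop

lemma looKDE_congr {h : ℝ} {n i : ℕ} {z z' : ℕ → EuclideanSpace ℝ (Fin d)}
    (hz : ∀ j ∈ (Finset.range n).erase i, z j = z' j) (x : EuclideanSpace ℝ (Fin d)) :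
    looKDE K h n z i x = looKDE K h n z' i x := by
  unfold looKDE
  congr 1
  exact Finset.sum_congr rfl fun j hj => by rw [hz j hj]

lemma abs_looKDE_le {C : ℝ} (hC : ∀ u, |K u| ≤ C) {h : ℝ} (hh : 0 < h) (n i : ℕ)
    (z : ℕ → EuclideanSpace ℝ (Fin d)) (x : EuclideanSpace ℝ (Fin d)) :
    |looKDE K h n z i x| ≤ ((n : ℝ) * h ^ d)⁻¹ * (n * C) := by
  have hC0 : 0 ≤ C := (abs_nonneg _).trans (hC 0)
  rw [looKDE, abs_mul, abs_of_nonneg (by positivity)]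
  gcongr
  calc _ ≤ ∑ j ∈ (Finset.range n).erase i, |K (h⁻¹ • (z j - x))| := Finset.abs_sum_le_sum_abs _ _
    _ ≤ ∑ j ∈ Finset.range n, C :=
        (Finset.sum_le_sum fun j _ => hC _).trans
          (Finset.sum_le_sum_of_subset_of_nonneg (Finset.erase_subset _ _) fun _ _ _ => hC0)
    _ = n * C := by simp

lemma card_range_erase {n i : ℕ} (hi : i < n) :
    (((Finset.range n).erase i).card : ℝ) = n - 1 := by
  rw [Finset.card_erase_of_mem (Finset.mem_range.2 hi), Finset.card_range,
    Nat.cast_sub (by omega), Nat.cast_one]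

/-- An upper bound for the mean square error of the leave-one-out kernel estimate. -/
noncomputable def mseBound (K : EuclideanSpace ℝ (Fin d) → ℝ) (r : ℕ) (M C h : ℝ) (n : ℕ) : ℝ :=
  3 * (((n : ℝ) * h ^ d)⁻¹ * ((∫ u, K u ^ 2) * M) + (C * h ^ r) ^ 2 +
    ((n : ℝ)⁻¹ * ((∫ u, |K u|) * M)) ^ 2)

namespace IsBoundedDensitySample

/-- The error splits into the fluctuation of the sum, the smoothing bias, and `n⁻¹ * kernelSmooth K
h f x`, which appears because `n - 1` summands are divided by `n`. The factor 3 in `mseBound` is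
that of `(p + q - t)² ≤ 3 (p² + q² + t²)`. -/
lemma integral_sq_looKDE_sub_le [IsProbabilityMeasure P] (hX : IsBoundedDensitySample P X f M)
    (hK : IsExpKernelOfOrder r K) {C h : ℝ} (hh : 0 < h)
    (hC : ∀ x, |kernelSmooth K h f x - f x| ≤ C * h ^ r) {n i : ℕ} (hi : i < n)
    (x : EuclideanSpace ℝ (Fin d)) :
    ∫ ω, (looKDE K h n (fun j => X j ω) i x - f x) ^ 2 ∂P ≤ mseBound K r M C h n := by
  have := hX.isProbabilityMeasure
  obtain ⟨CK, hCK0, hCK⟩ := hK.exists_bound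
  have hKm := hK.measurable
  have hn : (0 : ℝ) < n := by exact_mod_cast (by omega : 0 < n)
  have hkm : Measurable fun y : EuclideanSpace ℝ (Fin d) => K (h⁻¹ • (y - x)) := by fun_prop
  have hvar := integral_sq_sum_sub_le hX.measurable hX.indep hX.map_eq hkm (fun y => hCK _)
    ((Finset.range n).erase i)
  rw [hX.integral_kernel hh, card_range_erase hi] at hvar
  set S : Ω → ℝ := fun ω => ∑ j ∈ (Finset.range n).erase i, K (h⁻¹ • (X j ω - x)) -
    ((n : ℝ) - 1) * (h ^ d * kernelSmooth K h f x) with hS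
  have hvar' : ∫ ω, S ω ^ 2 ∂P ≤ n * (h ^ d * ((∫ u, K u ^ 2) * M)) := by
    refine hvar.trans ?_
    refine (mul_le_mul_of_nonneg_left (hX.integral_kernel_sq_le hK hh x) ?_).trans ?_
    · have : (1 : ℝ) ≤ n := by exact_mod_cast (by omega : 1 ≤ n)
      linarith
    · have h0 : 0 ≤ h ^ d * ((∫ u, K u ^ 2) * M) :=
        mul_nonneg (by positivity) (mul_nonneg (integral_nonneg fun u => sq_nonneg _)
          ((hX.nonneg 0).trans (hX.le 0)))
      nlinarith
  have hfs := hK.abs_kernelSmooth_le hX.abs_density_le h x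
  have hpt : ∀ ω, (looKDE K h n (fun j => X j ω) i x - f x) ^ 2 ≤
      3 * ((((n : ℝ) * h ^ d)⁻¹) ^ 2 * S ω ^ 2 + ((C * h ^ r) ^ 2 +
        ((n : ℝ)⁻¹ * ((∫ u, |K u|) * M)) ^ 2)) := by
    intro ω
    have e1 : looKDE K h n (fun j => X j ω) i x - f x =
        ((n : ℝ) * h ^ d)⁻¹ * S ω + (kernelSmooth K h f x - f x) -
          (n : ℝ)⁻¹ * kernelSmooth K h f x := by
      simp only [looKDE, hS]
      have : h ^ d ≠ 0 := by positivity
      field_simp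
      ring
    have h2 : (kernelSmooth K h f x - f x) ^ 2 ≤ (C * h ^ r) ^ 2 := by
      rw [← sq_abs]; exact pow_le_pow_left₀ (abs_nonneg _) (hC x) 2
    have h3 : ((n : ℝ)⁻¹ * kernelSmooth K h f x) ^ 2 ≤ ((n : ℝ)⁻¹ * ((∫ u, |K u|) * M)) ^ 2 := by
      rw [← sq_abs, abs_mul, abs_of_pos (inv_pos.2 hn)]
      exact pow_le_pow_left₀ (by positivity) (by gcongr) 2
    rw [e1, ← mul_pow]
    set p := ((n : ℝ) * h ^ d)⁻¹ * S ω
    set q := kernelSmooth K h f x - f x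
    set t := (n : ℝ)⁻¹ * kernelSmooth K h f x
    nlinarith [sq_nonneg (p - q), sq_nonneg (p + t), sq_nonneg (q + t)]
  have hXm := hX.measurable
  have hSm : Measurable S := by
    simp only [hS]; fun_prop
  have hSb : Integrable (fun ω => S ω ^ 2) P := by
    refine MemLp.integrable_sq (MemLp.of_bound hSm.aestronglyMeasurable
      (n * CK + |((n : ℝ) - 1) * (h ^ d * kernelSmooth K h f x)|) (ae_of_all _ fun ω => ?_))
    refine (norm_sub_le _ _).trans (add_le_add ?_ le_rfl)
    refine (Finset.abs_sum_le_sum_abs _ _).trans ?_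
    calc _ ≤ ∑ j ∈ Finset.range n, CK := (Finset.sum_le_sum fun j _ => hCK _).trans
          (Finset.sum_le_sum_of_subset_of_nonneg (Finset.erase_subset _ _) fun _ _ _ => hCK0.le)
      _ = n * CK := by simp
  calc ∫ ω, (looKDE K h n (fun j => X j ω) i x - f x) ^ 2 ∂P
      ≤ ∫ ω, 3 * ((((n : ℝ) * h ^ d)⁻¹) ^ 2 * S ω ^ 2 + ((C * h ^ r) ^ 2 +
        ((n : ℝ)⁻¹ * ((∫ u, |K u|) * M)) ^ 2)) ∂P :=
        integral_mono_of_nonneg (ae_of_all _ fun ω => sq_nonneg _)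
          (((hSb.const_mul _).add (integrable_const _)).const_mul _) (ae_of_all _ hpt)
    _ = 3 * ((((n : ℝ) * h ^ d)⁻¹) ^ 2 * ∫ ω, S ω ^ 2 ∂P) + 3 * ((C * h ^ r) ^ 2 +
        ((n : ℝ)⁻¹ * ((∫ u, |K u|) * M)) ^ 2) := by
        rw [integral_const_mul, integral_add (hSb.const_mul _) (integrable_const _),
          integral_const_mul]
        simp [mul_add]
    _ ≤ 3 * ((((n : ℝ) * h ^ d)⁻¹) ^ 2 * (n * (h ^ d * ((∫ u, K u ^ 2) * M)))) +
        3 * ((C * h ^ r) ^ 2 + ((n : ℝ)⁻¹ * ((∫ u, |K u|) * M)) ^ 2) := by gcongr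
    _ = mseBound K r M C h n := by
        have : h ^ d ≠ 0 := by positivity
        rw [mseBound]
        field_simp
        ring

/-- Leaving out the index `i` makes the estimate independent of the point `X i` at which it is
taken, so the bound at a fixed point can be integrated. -/
lemma integral_sq_looKDE_self_sub_le [IsProbabilityMeasure P] (hX : IsBoundedDensitySample P X f M)
    (hK : IsExpKernelOfOrder r K) {C h : ℝ} (hh : 0 < h)
    (hC : ∀ x, |kernelSmooth K h f x - f x| ≤ C * h ^ r) {n i : ℕ} (hi : i < n) :
    ∫ ω, (looKDE K h n (fun j => X j ω) i (X i ω) - f (X i ω)) ^ 2 ∂P ≤ mseBound K r M C h n := by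
  have := hX.isProbabilityMeasure
  obtain ⟨CK, hCK0, hCK⟩ := hK.exists_bound
  have hfm := hX.measurable_density
  set S := (Finset.range n).erase i
  have hcongr : ∀ ω x, looKDE K h n (fun j => if j ∈ S then X j ω else default) i x =
      looKDE K h n (fun j => X j ω) i x := fun ω x => looKDE_congr (fun j hj => if_pos hj) x
  have h1 := integral_comp_eq_integral_integral hX.measurable hX.indep hX.map_eq
    (i := i) (S := S) (Finset.notMem_erase _ _)
    (F := fun x z => (looKDE K h n z i x - f x) ^ 2)
    (((measurable_looKDE hK.measurable h n i).sub (hfm.comp measurable_fst)).pow_const 2)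
    (M := (((n : ℝ) * h ^ d)⁻¹ * (n * CK) + M) ^ 2) (fun x z => by
      rw [abs_pow]
      exact pow_le_pow_left₀ (abs_nonneg _) ((abs_sub _ _).trans
        (add_le_add (abs_looKDE_le hCK hh n i z x) (hX.abs_density_le x))) 2)
  simp only [hcongr] at h1
  rw [h1]
  calc _ ≤ ∫ x, mseBound K r M C h n ∂(volume.withDensity fun x => ENNReal.ofReal (f x)) :=
        integral_mono_of_nonneg (ae_of_all _ fun x => integral_nonneg fun ω => sq_nonneg _)
          (integrable_const _)
          (ae_of_all _ fun x => hX.integral_sq_looKDE_sub_le hK hh hC hi x)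
    _ = _ := by simp

/-- In units of `l * n * h ^ d` the Bernstein exponent is at most `b / 2 - 3 * b / 4 + b / 8 = - b /
8`: the threshold, the mean, and the quadratic term bounded through `hlM`. -/
lemma measureReal_looKDE_le_le [IsProbabilityMeasure P] (hX : IsBoundedDensitySample P X f M)
    (hK : IsExpKernelOfOrder r K) {h b l CK : ℝ} (hh : 0 < h) (hl : 0 ≤ l)
    (hCK : ∀ u, |K u| ≤ CK) (hlK : l * CK ≤ 1) (hlM : l * ((∫ u, K u ^ 2) * M) ≤ b / 8)
    {n i : ℕ} (hi : i < n) {x : EuclideanSpace ℝ (Fin d)}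
    (hx : 3 * b / 4 * n ≤ ((n : ℝ) - 1) * kernelSmooth K h f x) :
    P.real {ω | looKDE K h n (fun j => X j ω) i x ≤ b / 2} ≤
      Real.exp (-(l * b / 8) * (n * h ^ d)) := by
  have := hX.isProbabilityMeasure
  have hKm := hK.measurable
  have hn : (0 : ℝ) < n := by exact_mod_cast (by omega : 0 < n)
  have hkm : Measurable fun y : EuclideanSpace ℝ (Fin d) => K (h⁻¹ • (y - x)) := by fun_prop
  have h1 := measureReal_sum_le_le_exp hX.measurable hX.indep hX.map_eq hkm (fun y => hCK _)
    hl hlK ((Finset.range n).erase i) (b / 2 * (n * h ^ d))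
  have hset : {ω | looKDE K h n (fun j => X j ω) i x ≤ b / 2} =
      {ω | ∑ j ∈ (Finset.range n).erase i, K (h⁻¹ • (X j ω - x)) ≤ b / 2 * (n * h ^ d)} := by
    ext ω
    simp only [Set.mem_ofPred_eq, looKDE]
    rw [inv_mul_le_iff₀ (by positivity), mul_comm (b / 2)]
  rw [hset]
  refine h1.trans (Real.exp_le_exp.2 ?_)
  rw [hX.integral_kernel hh, card_range_erase hi]
  have h2 := hX.integral_kernel_sq_le hK hh x
  have hn1 : (0 : ℝ) ≤ (n : ℝ) - 1 := by
    have : (1 : ℝ) ≤ n := by exact_mod_cast (by omega : 1 ≤ n)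
    linarith
  have hhd : 0 < h ^ d := by positivity
  set m2 := (∫ u, K u ^ 2) * M
  have hm2 : 0 ≤ m2 := mul_nonneg (integral_nonneg fun u => sq_nonneg _)
    ((hX.nonneg 0).trans (hX.le 0))
  have h3 : l ^ 2 * (((n : ℝ) - 1) * ∫ y, K (h⁻¹ • (y - x)) ^ 2
      ∂(volume.withDensity fun x => ENNReal.ofReal (f x))) ≤ l * (b / 8) * (n * h ^ d) := by
    calc _ ≤ l ^ 2 * (n * (h ^ d * m2)) := by
          gcongr
          linarith
      _ = l * (l * m2) * (n * h ^ d) := by ring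
      _ ≤ l * (b / 8) * (n * h ^ d) := by gcongr
  have h4 : l * h ^ d * (3 * b / 4 * n) ≤ l * h ^ d * (((n : ℝ) - 1) * kernelSmooth K h f x) := by
    gcongr
  nlinarith

lemma measureReal_looKDE_self_le_le [IsProbabilityMeasure P] (hX : IsBoundedDensitySample P X f M)
    (hK : IsExpKernelOfOrder r K) {h b l CK : ℝ} (hh : 0 < h) (hl : 0 ≤ l)
    (hCK : ∀ u, |K u| ≤ CK) (hlK : l * CK ≤ 1) (hlM : l * ((∫ u, K u ^ 2) * M) ≤ b / 8)
    {n i : ℕ} (hi : i < n)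
    (hx : ∀ x, b ≤ f x → 3 * b / 4 * n ≤ ((n : ℝ) - 1) * kernelSmooth K h f x) :
    P.real {ω | b ≤ f (X i ω) ∧ looKDE K h n (fun j => X j ω) i (X i ω) ≤ b / 2} ≤
      Real.exp (-(l * b / 8) * (n * h ^ d)) := by
  classical
  have := hX.isProbabilityMeasure
  have hfm := hX.measurable_density
  have hXm' : Measurable fun ω j => X j ω := measurable_pi_lambda _ hX.measurable
  set S := (Finset.range n).erase i
  have hcongr : ∀ ω x, looKDE K h n (fun j => if j ∈ S then X j ω else default) i x =
      looKDE K h n (fun j => X j ω) i x := fun ω x => looKDE_congr (fun j hj => if_pos hj) x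
  have hFset : MeasurableSet
      {p : EuclideanSpace ℝ (Fin d) × (ℕ → EuclideanSpace ℝ (Fin d)) |
        b ≤ f p.1 ∧ looKDE K h n p.2 i p.1 ≤ b / 2} :=
    (measurableSet_le measurable_const (hfm.comp measurable_fst)).inter
      (measurableSet_le (measurable_looKDE hK.measurable h n i) measurable_const)
  have h1 := integral_comp_eq_integral_integral hX.measurable hX.indep hX.map_eq
    (i := i) (S := S) (Finset.notMem_erase _ _)
    (F := fun x z => if b ≤ f x ∧ looKDE K h n z i x ≤ b / 2 then (1 : ℝ) else 0)
    (Measurable.ite hFset measurable_const measurable_const) (M := 1)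
    (fun x z => by split_ifs <;> simp)
  simp only [hcongr] at h1
  have hreal : ∀ {T : Ω → Prop} [DecidablePred T], MeasurableSet {ω | T ω} →
      ∫ ω, (if T ω then (1 : ℝ) else 0) ∂P = P.real {ω | T ω} := by
    intro T _ hT
    rw [← integral_indicator_one hT]
    refine integral_congr_ae (ae_of_all _ fun ω => ?_)
    by_cases hω : T ω <;> simp [hω]
  rw [hreal (T := fun ω => b ≤ f (X i ω) ∧
    looKDE K h n (fun j => X j ω) i (X i ω) ≤ b / 2)
    (hFset.preimage ((hX.measurable i).prodMk hXm'))] at h1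
  rw [h1]
  calc _ ≤ ∫ x, Real.exp (-(l * b / 8) * (n * h ^ d))
        ∂(volume.withDensity fun x => ENNReal.ofReal (f x)) := by
        refine integral_mono_of_nonneg (ae_of_all _ fun x => integral_nonneg fun ω => ?_)
          (integrable_const _) (ae_of_all _ fun x => ?_)
        · beta_reduce; split_ifs <;> simp
        · beta_reduce
          rw [hreal (T := fun ω => b ≤ f x ∧ looKDE K h n (fun j => X j ω) i x ≤ b / 2)
            (hFset.preimage (measurable_const.prodMk hXm'))]
          by_cases hbx : b ≤ f x
          · simp only [hbx, true_and]
            exact hX.measureReal_looKDE_le_le hK hh hl hCK hlK hlM hi (hx x hbx)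
          · simp only [hbx, false_and]
            simpa using Real.exp_nonneg _
    _ = _ := by simp

end IsBoundedDensitySample

end KernelEstimate

/-! ### The linearized estimator is negligible at scale √n. -/

section LinearPart

variable {Ω : Type*} [MeasurableSpace Ω] {P : Measure Ω} {d r : ℕ}
  {X : ℕ → Ω → EuclideanSpace ℝ (Fin d)} {f K w : EuclideanSpace ℝ (Fin d) → ℝ} {M : ℝ}

/-- The error of `(1/n) ∑ (2 w f - w f̂)`, a linearization of `(1/n) ∑ w f² / f̂`, as an estimate
of `∫ w f²`, on the `√n` scale. -/
noncomputable def linearizedError (K w f : EuclideanSpace ℝ (Fin d) → ℝ) (h : ℝ) (n : ℕ)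
    (z : ℕ → EuclideanSpace ℝ (Fin d)) : ℝ :=
  √(n : ℝ) * ((n : ℝ)⁻¹ * ∑ i ∈ Finset.range n,
    (2 * (w (z i) * f (z i)) - w (z i) * looKDE K h n z i (z i)) - ∫ x, w x * f x ^ 2)

lemma measurable_linearizedError (hK : Measurable K) (hw : Measurable w) (hf : Measurable f)
    (h : ℝ) (n : ℕ) : Measurable (linearizedError K w f h n) := by
  have := measurable_looKDE_self hK h n
  unfold linearizedError
  fun_prop

lemma abs_linearizedError_le (hX : IsBoundedDensitySample P X f M)
    {CK W h : ℝ} (hCK : ∀ u, |K u| ≤ CK) (hW : ∀ x, |w x| ≤ W) (hh : 0 < h) (n : ℕ) :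
    ∃ B : ℝ, ∀ z, |linearizedError K w f h n z| ≤ B := by
  have hW0 : 0 ≤ W := (abs_nonneg _).trans (hW 0)
  have hM0 : 0 ≤ M := (hX.nonneg 0).trans (hX.le 0)
  refine ⟨√(n : ℝ) * ((n : ℝ)⁻¹ * ∑ i ∈ Finset.range n,
    (2 * (W * M) + W * (((n : ℝ) * h ^ d)⁻¹ * (n * CK))) + |∫ x, w x * f x ^ 2|), fun z => ?_⟩
  rw [linearizedError, abs_mul, abs_of_nonneg (Real.sqrt_nonneg _)]
  refine mul_le_mul_of_nonneg_left ((abs_sub _ _).trans (add_le_add ?_ le_rfl))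
    (Real.sqrt_nonneg _)
  rw [abs_mul, abs_of_nonneg (by positivity : (0 : ℝ) ≤ (n : ℝ)⁻¹)]
  refine mul_le_mul_of_nonneg_left ((Finset.abs_sum_le_sum_abs _ _).trans
    (Finset.sum_le_sum fun i _ => ?_)) (by positivity)
  refine (abs_sub _ _).trans (add_le_add ?_ ?_)
  · rw [abs_mul, abs_mul, abs_two]
    have := hX.abs_density_le (z i)
    have := hW (z i)
    gcongr
  · rw [abs_mul]
    exact mul_le_mul (hW _) (abs_looKDE_le hCK hh n i z _) (abs_nonneg _) hW0

/-- The kernel of the `U`-statistic that appears in `linearizedError`. -/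
noncomputable def pairKernel (K w : EuclideanSpace ℝ (Fin d) → ℝ) (h : ℝ)
    (x y : EuclideanSpace ℝ (Fin d)) : ℝ := w x * ((h ^ d)⁻¹ * K (h⁻¹ • (y - x)))

lemma measurable_pairKernel (hK : Measurable K) (hw : Measurable w) (h : ℝ) :
    Measurable (Function.uncurry (pairKernel K w h)) := by
  unfold pairKernel Function.uncurry
  fun_prop

lemma abs_pairKernel_le {CK W h : ℝ} (hCK : ∀ u, |K u| ≤ CK) (hW : ∀ x, |w x| ≤ W) (hh : 0 < h)
    (x y : EuclideanSpace ℝ (Fin d)) : |pairKernel K w h x y| ≤ W * ((h ^ d)⁻¹ * CK) := by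
  have hW0 : 0 ≤ W := (abs_nonneg _).trans (hW 0)
  rw [pairKernel, abs_mul, abs_mul, abs_of_nonneg (by positivity : 0 ≤ (h ^ d)⁻¹)]
  have := hCK (h⁻¹ • (y - x))
  have := hW x
  gcongr

/-- The `L²` bound for the projection part of `linearizedError`. -/
noncomputable def projectionBound (K w f : EuclideanSpace ℝ (Fin d) → ℝ) (M W b h : ℝ) : ℝ :=
  2 * (W * b) ^ 2 + 2 * ((M * ((1 + ∫ u, |K u|) * (W * M))) *
    ∫ y, |kernelSmooth K h (fun x => w x * f x) y - w y * f y|)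

lemma measurable_kernelSmooth {q : EuclideanSpace ℝ (Fin d) → ℝ} (hK : Measurable K)
    (hq : Measurable q) (h : ℝ) : Measurable (kernelSmooth K h q) := by
  refine (StronglyMeasurable.integral_prod_right
    (f := fun x u => K u * q (x + h • u)) ?_).measurable
  refine Measurable.stronglyMeasurable (Measurable.mul (hK.comp measurable_snd) (hq.comp ?_))
  fun_prop

lemma IsExpKernelOfOrder.integrable_kernelSmooth (hK : IsExpKernelOfOrder r K)
    {q : EuclideanSpace ℝ (Fin d) → ℝ} (hq : Measurable q) (hqi : Integrable q) (h : ℝ) :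
    Integrable (kernelSmooth K h q) := by
  have hm : Measurable fun p : EuclideanSpace ℝ (Fin d) × EuclideanSpace ℝ (Fin d) =>
      K p.2 * q (p.1 + h • p.2) :=
    Measurable.mul (hK.measurable.comp measurable_snd) (hq.comp (by fun_prop))
  have hprod : Integrable (fun p : EuclideanSpace ℝ (Fin d) × EuclideanSpace ℝ (Fin d) =>
      K p.2 * q (p.1 + h • p.2)) (volume.prod volume) := by
    rw [integrable_prod_iff' hm.aestronglyMeasurable]
    refine ⟨ae_of_all _ fun u => (hqi.comp_add_right (h • u)).const_mul (K u), ?_⟩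
    simp only [norm_mul, integral_const_mul]
    have : ∀ u, ∫ x, ‖q (x + h • u)‖ = ∫ x, ‖q x‖ := fun u =>
      integral_add_right_eq_self (fun x => ‖q x‖) (h • u)
    simp only [this]
    exact hK.integrable.norm.mul_const _
  exact hprod.integral_prod_left

namespace IsBoundedDensitySample

lemma integral_pairKernel_right [IsProbabilityMeasure P]
    (hX : IsBoundedDensitySample P X f M) {h : ℝ} (hh : 0 < h)
    (x : EuclideanSpace ℝ (Fin d)) :
    ∫ y, pairKernel K w h x y ∂(volume.withDensity fun x => ENNReal.ofReal (f x)) =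
      w x * kernelSmooth K h f x := by
  simp only [pairKernel]
  rw [integral_const_mul, integral_const_mul, hX.integral_kernel hh, ← mul_assoc (h ^ d)⁻¹,
    inv_mul_cancel₀ (by positivity), one_mul]

/-- Integrating out the first variable produces the reflected kernel, which symmetry identifies with
`K`. -/
lemma integral_pairKernel_left (hX : IsBoundedDensitySample P X f M)
    (hK : IsExpKernelOfOrder r K) {h : ℝ} (hh : 0 < h) (y : EuclideanSpace ℝ (Fin d)) :
    ∫ x, pairKernel K w h x y ∂(volume.withDensity fun x => ENNReal.ofReal (f x)) =
      kernelSmooth K h (fun x => w x * f x) y := by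
  rw [integral_withDensity_ofReal hX.measurable_density hX.nonneg, kernelSmooth_eq hh]
  congr 1 with x
  rw [pairKernel, ← hK.symmetric, ← smul_neg, neg_sub]
  ring

lemma integral_pairKernel_sq_le [IsProbabilityMeasure P] (hX : IsBoundedDensitySample P X f M)
    (hK : IsExpKernelOfOrder r K) {W h : ℝ} (hW : ∀ x, |w x| ≤ W)
    (hh : 0 < h) :
    ∫ x, ∫ y, pairKernel K w h x y ^ 2 ∂(volume.withDensity fun x => ENNReal.ofReal (f x))
      ∂(volume.withDensity fun x => ENNReal.ofReal (f x)) ≤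
        W ^ 2 * ((h ^ d)⁻¹ * ((∫ u, K u ^ 2) * M)) := by
  have := hX.isProbabilityMeasure
  have hpt : ∀ x, ∫ y, pairKernel K w h x y ^ 2
      ∂(volume.withDensity fun x => ENNReal.ofReal (f x)) ≤
      W ^ 2 * ((h ^ d)⁻¹ * ((∫ u, K u ^ 2) * M)) := by
    intro x
    simp only [pairKernel, mul_pow]
    rw [integral_const_mul, integral_const_mul]
    have h1 := hX.integral_kernel_sq_le hK hh x
    have h2 : w x ^ 2 ≤ W ^ 2 := by
      rw [← sq_abs]; exact pow_le_pow_left₀ (abs_nonneg _) (hW x) 2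
    have h3 : 0 ≤ ((h ^ d)⁻¹) ^ 2 * ∫ y, K (h⁻¹ • (y - x)) ^ 2
        ∂(volume.withDensity fun x => ENNReal.ofReal (f x)) :=
      mul_nonneg (by positivity) (integral_nonneg fun y => sq_nonneg _)
    refine mul_le_mul h2 ?_ h3 (sq_nonneg _)
    calc _ ≤ ((h ^ d)⁻¹) ^ 2 * (h ^ d * ((∫ u, K u ^ 2) * M)) :=
          mul_le_mul_of_nonneg_left h1 (by positivity)
      _ = _ := by
          have : h ^ d ≠ 0 := by positivity
          field_simp
  calc _ ≤ ∫ x, W ^ 2 * ((h ^ d)⁻¹ * ((∫ u, K u ^ 2) * M))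
        ∂(volume.withDensity fun x => ENNReal.ofReal (f x)) :=
        integral_mono_of_nonneg (ae_of_all _ fun x => integral_nonneg fun y => sq_nonneg _)
          (integrable_const _) (ae_of_all _ hpt)
    _ = _ := by simp

/-- With `q = w f`, the projection is `-w (K_h f - f) - (K_h q - q)`. The first term is uniformly
small. The second is controlled only in `L¹`, but it is bounded, so its square is at most a constant
times its absolute value. No rate is needed here, since the projections of different points are
independent. -/
lemma integral_sq_projection_le [IsProbabilityMeasure P] (hX : IsBoundedDensitySample P X f M)
    (hK : IsExpKernelOfOrder r K) (hw : Measurable w) {W b h : ℝ} (hW : ∀ x, |w x| ≤ W)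
    (hwi : Integrable fun x => w x * f x)
    (hb : ∀ x, |kernelSmooth K h f x - f x| ≤ b) :
    ∫ x, (2 * (w x * f x) - w x * kernelSmooth K h f x -
        kernelSmooth K h (fun x => w x * f x) x) ^ 2
      ∂(volume.withDensity fun x => ENNReal.ofReal (f x)) ≤ projectionBound K w f M W b h := by
  have := hX.isProbabilityMeasure
  have hfm := hX.measurable_density
  have hKm := hK.measurable
  have hW0 : 0 ≤ W := (abs_nonneg _).trans (hW 0)
  have hM0 : 0 ≤ M := (hX.nonneg 0).trans (hX.le 0)
  have hA0 : 0 ≤ ∫ u, |K u| := integral_nonneg fun u => abs_nonneg _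
  set q : EuclideanSpace ℝ (Fin d) → ℝ := fun x => w x * f x with hq
  have hqm : Measurable q := hw.mul hfm
  have hqb : ∀ x, |q x| ≤ W * M := fun x => by
    rw [hq, abs_mul]
    exact mul_le_mul (hW x) (hX.abs_density_le x) (abs_nonneg _) hW0
  have hsm : Measurable (kernelSmooth K h q) := measurable_kernelSmooth hKm hqm h
  set g : EuclideanSpace ℝ (Fin d) → ℝ := fun y => kernelSmooth K h q y - q y with hg
  have hgm : Measurable g := hsm.sub hqm
  have hgb : ∀ x, |g x| ≤ (1 + ∫ u, |K u|) * (W * M) := fun x => by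
    refine (abs_sub _ _).trans ?_
    linarith [hK.abs_kernelSmooth_le hqb h x, hqb x]
  have hgi : Integrable g := (hK.integrable_kernelSmooth hqm hwi h).sub hwi
  have hpt : ∀ x, (2 * q x - w x * kernelSmooth K h f x - kernelSmooth K h q x) ^ 2 ≤
      2 * (W * b) ^ 2 + 2 * (((1 + ∫ u, |K u|) * (W * M)) * |g x|) := by
    intro x
    have e1 : 2 * q x - w x * kernelSmooth K h f x - kernelSmooth K h q x =
        -(w x * (kernelSmooth K h f x - f x)) - g x := by simp only [hg, hq]; ring
    have h1 : (w x * (kernelSmooth K h f x - f x)) ^ 2 ≤ (W * b) ^ 2 := by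
      rw [← sq_abs, abs_mul]
      exact pow_le_pow_left₀ (by positivity)
        (mul_le_mul (hW x) (hb x) (abs_nonneg _) hW0) 2
    have h2 : g x ^ 2 ≤ ((1 + ∫ u, |K u|) * (W * M)) * |g x| := by
      rw [← sq_abs, pow_two]
      exact mul_le_mul_of_nonneg_right (hgb x) (abs_nonneg _)
    rw [e1]
    nlinarith [sq_nonneg (w x * (kernelSmooth K h f x - f x) - g x)]
  have hgiμ : Integrable (fun x => |g x|) (volume.withDensity fun x => ENNReal.ofReal (f x)) :=
    integrable_of_abs_le hgm.abs fun x => by rw [abs_abs]; exact hgb x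
  have hgμ : ∫ x, |g x| ∂(volume.withDensity fun x => ENNReal.ofReal (f x)) ≤
      M * ∫ x, |g x| := by
    rw [integral_withDensity_ofReal hfm hX.nonneg, ← integral_const_mul]
    refine integral_mono_of_nonneg (ae_of_all _ fun x => mul_nonneg (abs_nonneg _) (hX.nonneg x))
      (hgi.abs.const_mul _) (ae_of_all _ fun x => ?_)
    beta_reduce
    rw [mul_comm]
    exact mul_le_mul_of_nonneg_right (hX.le x) (abs_nonneg _)
  set C := (1 + ∫ u, |K u|) * (W * M) with hC
  have hC0 : 0 ≤ C := by positivity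
  have hi : Integrable (fun x => 2 * (C * |g x|))
      (volume.withDensity fun x => ENNReal.ofReal (f x)) := (hgiμ.const_mul C).const_mul 2
  have hmono : ∫ x, (2 * q x - w x * kernelSmooth K h f x - kernelSmooth K h q x) ^ 2
      ∂(volume.withDensity fun x => ENNReal.ofReal (f x)) ≤
      ∫ x, (2 * (W * b) ^ 2 + 2 * (C * |g x|))
        ∂(volume.withDensity fun x => ENNReal.ofReal (f x)) :=
    integral_mono_of_nonneg (ae_of_all _ fun x => sq_nonneg _) ((integrable_const _).add hi)
      (ae_of_all _ hpt)
  have hconst : ∫ x, 2 * (C * |g x|) ∂(volume.withDensity fun x => ENNReal.ofReal (f x)) =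
      2 * (C * ∫ x, |g x| ∂(volume.withDensity fun x => ENNReal.ofReal (f x))) := by
    rw [integral_const_mul, integral_const_mul]
  rw [integral_add (integrable_const _) hi, hconst, integral_const, probReal_univ,
    one_smul] at hmono
  refine hmono.trans ?_
  have : projectionBound K w f M W b h =
      2 * (W * b) ^ 2 + 2 * (C * (M * ∫ x, |g x|)) := by
    rw [projectionBound, ← hC]
    ring
  rw [this]
  linarith [mul_le_mul_of_nonneg_left hgμ hC0]

lemma integral_abs_linearizedError_le [IsProbabilityMeasure P] (hX : IsBoundedDensitySample P X f M)
    (hK : IsExpKernelOfOrder r K) (hw : Measurable w) {W b h : ℝ} (hW : ∀ x, |w x| ≤ W)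
    (hwi : Integrable fun x => w x * f x) (hh : 0 < h)
    (hb : ∀ x, |kernelSmooth K h f x - f x| ≤ b) {n : ℕ} (hn : 0 < n) :
    ∫ ω, |linearizedError K w f h n (fun j => X j ω)| ∂P ≤
      √(2 * (W ^ 2 * ((∫ u, K u ^ 2) * M)) * ((n : ℝ) * h ^ d)⁻¹) +
        √(projectionBound K w f M W b h) + √(n : ℝ) * (W * b) +
        (√(n : ℝ))⁻¹ * (3 * (W * ((∫ u, |K u|) * M))) := by
  have := hX.isProbabilityMeasure
  obtain ⟨CK, hCK0, hCK⟩ := hK.exists_bound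
  have hfm := hX.measurable_density
  have hKm := hK.measurable
  have hW0 : 0 ≤ W := (abs_nonneg _).trans (hW 0)
  have hM0 : 0 ≤ M := (hX.nonneg 0).trans (hX.le 0)
  set A := ∫ u, |K u| with hA
  have hA0 : 0 ≤ A := integral_nonneg fun u => abs_nonneg _
  set μ : Measure (EuclideanSpace ℝ (Fin d)) :=
    volume.withDensity fun x => ENNReal.ofReal (f x) with hμ
  set q : EuclideanSpace ℝ (Fin d) → ℝ := fun x => w x * f x with hq
  set A1 : EuclideanSpace ℝ (Fin d) → ℝ := fun x => w x * kernelSmooth K h f x with hA1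
  set A2 : EuclideanSpace ℝ (Fin d) → ℝ := kernelSmooth K h q with hA2
  have ham := measurable_pairKernel hKm hw h
  have haM := abs_pairKernel_le hCK hW hh
  have hA1eq : ∀ x, ∫ y, pairKernel K w h x y ∂μ = A1 x := fun x =>
    hX.integral_pairKernel_right hh x
  have hA2eq : ∀ y, ∫ x, pairKernel K w h x y ∂μ = A2 y := fun y =>
    hX.integral_pairKernel_left hK hh y
  have hqm : Measurable q := hw.mul hfm
  have hA1m : Measurable A1 := by
    have := measurable_integral_right (μ := μ) ham
    simpa only [hA1eq] using this
  have hA2m : Measurable A2 := by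
    have := measurable_integral_left (μ := μ) ham
    simpa only [hA2eq] using this
  have hqb : ∀ x, |q x| ≤ W * M := fun x => by
    rw [hq, abs_mul]
    exact mul_le_mul (hW x) (hX.abs_density_le x) (abs_nonneg _) hW0
  have hA1b : ∀ x, |A1 x| ≤ W * (A * M) := fun x => by
    rw [hA1, abs_mul]
    exact mul_le_mul (hW x) (hK.abs_kernelSmooth_le hX.abs_density_le h x) (abs_nonneg _) hW0
  have hA2b : ∀ x, |A2 x| ≤ W * (A * M) := fun x =>
    (hK.abs_kernelSmooth_le hqb h x).trans_eq (by ring)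
  set θ := ∫ x, A1 x ∂μ with hθ
  have hθ2 : ∫ x, A2 x ∂μ = θ := by
    have := integral_integral_swap_of_abs_le (μ := μ) ham haM
    simp only [hA1eq, hA2eq] at this
    exact this.symm
  have hθb : |θ| ≤ W * (A * M) := abs_integral_le_of_abs_le hA1b
  set c := ∫ x, w x * f x ^ 2 with hc
  have hcq : ∫ x, q x ∂μ = c := by
    rw [hμ, integral_withDensity_ofReal hfm hX.nonneg]
    congr 1 with x
    simp only [hq]
    ring
  -- The only term that is multiplied by √n without any averaging, hence the condition on `√n * h ^
  -- r`.
  have hcθ : |c - θ| ≤ W * b := by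
    rw [← hcq, hθ, ← integral_sub (integrable_of_abs_le hqm hqb) (integrable_of_abs_le hA1m hA1b)]
    refine abs_integral_le_of_abs_le fun x => ?_
    have : q x - A1 x = -(w x * (kernelSmooth K h f x - f x)) := by simp only [hq, hA1]; ring
    rw [this, abs_neg, abs_mul]
    exact mul_le_mul (hW x) (hb x) (abs_nonneg _) hW0
  set D : EuclideanSpace ℝ (Fin d) → ℝ := fun x => 2 * q x - A1 x - A2 x with hD
  have hDm : Measurable D := ((hqm.const_mul 2).sub hA1m).sub hA2m
  have hDb : ∀ x, |D x| ≤ 2 * (W * M) + W * (A * M) + W * (A * M) := fun x => by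
    refine (abs_sub _ _).trans (add_le_add ((abs_sub _ _).trans (add_le_add ?_ (hA1b x)))
      (hA2b x))
    rw [abs_mul, abs_two]
    linarith [hqb x]
  have hDint : ∫ x, D x ∂μ = 2 * c - 2 * θ := by
    have i1 : Integrable (fun x => 2 * q x) μ := (integrable_of_abs_le hqm hqb).const_mul 2
    have i2 : Integrable A1 μ := integrable_of_abs_le hA1m hA1b
    have i3 : Integrable A2 μ := integrable_of_abs_le hA2m hA2b
    have i4 : Integrable (fun x => 2 * q x - A1 x) μ := i1.sub i2
    simp only [hD]
    rw [integral_sub i4 i3, integral_sub i1 i2, integral_const_mul, hcq, hθ2]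
    ring
  set res := hoeffdingResidual μ (pairKernel K w h) with hres
  have hresm : Measurable (Function.uncurry res) := measurable_hoeffdingResidual ham
  have hresb := abs_hoeffdingResidual_le (μ := μ) haM
  have hXm := hX.measurable
  have hn' : (0 : ℝ) < n := by exact_mod_cast hn
  set s := √(n : ℝ) with hs
  have hs0 : 0 < s := Real.sqrt_pos.2 hn'
  have hss : s * s = n := Real.mul_self_sqrt hn'.le
  set U : Ω → ℝ := fun ω => ∑ i ∈ Finset.range n, ∑ j ∈ (Finset.range n).erase i,
    res (X i ω) (X j ω) with hU
  set Z : Ω → ℝ := fun ω => ∑ i ∈ Finset.range n, D (X i ω) - n * ∫ x, D x ∂μ with hZ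
  -- The four terms are the degenerate U-statistic, the centred sum of projections, the bias, and a
  -- correction of order `n^{-1/2}` due to `n (n - 1)` pairs being divided by `n ^ 2`.
  have hdecomp : ∀ ω, linearizedError K w f h n (fun j => X j ω) =
      -((n : ℝ)⁻¹ * s⁻¹ * U ω) + s⁻¹ * Z ω + s * (c - θ) +
      s⁻¹ * ((n : ℝ)⁻¹ * ∑ i ∈ Finset.range n, (A1 (X i ω) + A2 (X i ω)) - θ) := by
    intro ω
    have hwF : ∀ i, w (X i ω) * looKDE K h n (fun j => X j ω) i (X i ω) =
        (n : ℝ)⁻¹ * ∑ j ∈ (Finset.range n).erase i, pairKernel K w h (X i ω) (X j ω) := by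
      intro i
      simp only [looKDE, pairKernel, ← Finset.mul_sum]
      rw [mul_inv]
      ring
    have hUeq : U ω = ∑ i ∈ Finset.range n, ∑ j ∈ (Finset.range n).erase i,
        pairKernel K w h (X i ω) (X j ω) -
        ((n : ℝ) - 1) * ∑ i ∈ Finset.range n, (A1 (X i ω) + A2 (X i ω)) +
        n * (((n : ℝ) - 1) * θ) := by
      have h1 : ∀ i ∈ Finset.range n, ∑ j ∈ (Finset.range n).erase i, res (X i ω) (X j ω) =
          ∑ j ∈ (Finset.range n).erase i, pairKernel K w h (X i ω) (X j ω) -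
            ((n : ℝ) - 1) * A1 (X i ω) - (∑ j ∈ Finset.range n, A2 (X j ω) - A2 (X i ω)) +
            ((n : ℝ) - 1) * θ := by
        intro i hi
        have hres' : ∀ x y, res x y = pairKernel K w h x y - A1 x - A2 y + θ := by
          intro x y
          rw [hres, hoeffdingResidual]
          simp only [hA1eq, hA2eq]
          rfl
        simp only [hres', Finset.sum_add_distrib, Finset.sum_sub_distrib, Finset.sum_const,
          nsmul_eq_mul]
        rw [card_range_erase (Finset.mem_range.1 hi),
          Finset.sum_erase_eq_sub (f := fun j => A2 (X j ω)) hi]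
      simp only [hU]
      rw [Finset.sum_congr rfl h1]
      simp only [Finset.sum_add_distrib, Finset.sum_sub_distrib, Finset.sum_const,
        nsmul_eq_mul, ← Finset.mul_sum, Finset.card_range]
      ring
    have hZeq : Z ω = 2 * ∑ i ∈ Finset.range n, q (X i ω) -
        ∑ i ∈ Finset.range n, (A1 (X i ω) + A2 (X i ω)) - n * (2 * c - 2 * θ) := by
      simp only [hZ]
      rw [hDint]
      simp only [hD, Finset.sum_sub_distrib, Finset.sum_add_distrib, ← Finset.mul_sum]
      ring
    rw [linearizedError, hUeq, hZeq]
    simp only [hwF, Finset.sum_sub_distrib, ← Finset.mul_sum]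
    change s * ((n : ℝ)⁻¹ * (2 * ∑ i ∈ Finset.range n, q (X i ω) - _) - c) = _
    have hsn : s * (n : ℝ)⁻¹ = s⁻¹ := by
      rw [← hss]; field_simp
    have hn0 := hn'.ne'
    have hs0' := hs0.ne'
    field_simp
    rw [pow_two, hss]
    ring
  have hUm : Measurable U := by
    simp only [hU]
    refine Finset.measurable_sum _ fun i _ => Finset.measurable_sum _ fun j _ => ?_
    exact hresm.comp ((hXm i).prodMk (hXm j))
  have hZm : Measurable Z :=
    (Finset.measurable_sum _ fun i _ => hDm.comp (hXm i)).sub_const _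
  have hU2 : MemLp U 2 P := by
    have : ∀ i j, MemLp (fun ω => res (X i ω) (X j ω)) 2 P := fun i j =>
      MemLp.of_bound (hresm.comp ((hXm i).prodMk (hXm j))).aestronglyMeasurable _
        (ae_of_all _ fun ω => hresb _ _)
    exact memLp_finsetSum _ fun i _ => memLp_finsetSum _ fun j _ => this i j
  have hZ2 : MemLp Z 2 P := by
    have : ∀ i, MemLp (fun ω => D (X i ω)) 2 P := fun i =>
      MemLp.of_bound (hDm.comp (hXm i)).aestronglyMeasurable _ (ae_of_all _ fun ω => hDb _)
    exact (memLp_finsetSum _ fun i _ => this i).sub (memLp_const _)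
  have hUsq : ∫ ω, U ω ^ 2 ∂P ≤
      2 * (n : ℝ) ^ 2 * (W ^ 2 * ((h ^ d)⁻¹ * ((∫ u, K u ^ 2) * M))) := by
    refine (integral_sq_sum_degenerate_le hXm hX.indep hX.map_eq hresm hresb
      (integral_hoeffdingResidual_right ham haM) (integral_hoeffdingResidual_left ham haM) n).trans
      ?_
    refine mul_le_mul_of_nonneg_left ?_ (by positivity)
    exact (integral_hoeffdingResidual_sq_le ham haM).trans
      (hX.integral_pairKernel_sq_le hK hW hh)
  have hZsq : ∫ ω, Z ω ^ 2 ∂P ≤ n * projectionBound K w f M W b h := by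
    have h1 := integral_sq_sum_sub_le hXm hX.indep hX.map_eq hDm hDb (Finset.range n)
    rw [Finset.card_range] at h1
    exact h1.trans (mul_le_mul_of_nonneg_left (hX.integral_sq_projection_le hK hw hW hwi hb)
      hn'.le)
  have hU1 : ∫ ω, |(n : ℝ)⁻¹ * s⁻¹ * U ω| ∂P ≤
      √(2 * (W ^ 2 * ((∫ u, K u ^ 2) * M)) * ((n : ℝ) * h ^ d)⁻¹) := by
    refine integral_abs_le_sqrt_of_integral_sq_le (hU2.const_mul _) ?_
    simp only [mul_pow]
    rw [integral_const_mul]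
    calc _ ≤ (n : ℝ)⁻¹ ^ 2 * s⁻¹ ^ 2 *
          (2 * (n : ℝ) ^ 2 * (W ^ 2 * ((h ^ d)⁻¹ * ((∫ u, K u ^ 2) * M)))) :=
          mul_le_mul_of_nonneg_left hUsq (by positivity)
      _ = _ := by
          rw [inv_pow s, pow_two s, hss]
          have : h ^ d ≠ 0 := by positivity
          field_simp
  have hZ1 : ∫ ω, |s⁻¹ * Z ω| ∂P ≤ √(projectionBound K w f M W b h) := by
    refine integral_abs_le_sqrt_of_integral_sq_le (hZ2.const_mul _) ?_
    simp only [mul_pow]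
    rw [integral_const_mul]
    calc _ ≤ s⁻¹ ^ 2 * (n * projectionBound K w f M W b h) :=
          mul_le_mul_of_nonneg_left hZsq (by positivity)
      _ = _ := by
          rw [inv_pow s, pow_two s, hss]
          field_simp
  have hiU : Integrable (fun ω => |(n : ℝ)⁻¹ * s⁻¹ * U ω|) P :=
    ((hU2.const_mul _).integrable (by norm_num)).abs
  have hiZ : Integrable (fun ω => |s⁻¹ * Z ω|) P :=
    ((hZ2.const_mul _).integrable (by norm_num)).abs
  have hi3 : Integrable (fun ω => |(n : ℝ)⁻¹ * s⁻¹ * U ω| + |s⁻¹ * Z ω|) P := hiU.add hiZ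
  calc ∫ ω, |linearizedError K w f h n (fun j => X j ω)| ∂P
      ≤ ∫ ω, (|(n : ℝ)⁻¹ * s⁻¹ * U ω| + |s⁻¹ * Z ω| +
          (s * (W * b) + s⁻¹ * (3 * (W * (A * M))))) ∂P := by
        refine integral_mono_of_nonneg (ae_of_all _ fun ω => abs_nonneg _)
          (hi3.add (integrable_const _)) (ae_of_all _ fun ω => ?_)
        beta_reduce
        rw [hdecomp]
        have h1 : |s * (c - θ)| ≤ s * (W * b) := by
          rw [abs_mul, abs_of_pos hs0]; gcongr
        have h2 : |s⁻¹ * ((n : ℝ)⁻¹ * ∑ i ∈ Finset.range n, (A1 (X i ω) + A2 (X i ω)) - θ)| ≤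
            s⁻¹ * (3 * (W * (A * M))) := by
          rw [abs_mul, abs_of_pos (inv_pos.2 hs0)]
          refine mul_le_mul_of_nonneg_left ((abs_sub _ _).trans ?_) (by positivity)
          have h3 : |(n : ℝ)⁻¹ * ∑ i ∈ Finset.range n, (A1 (X i ω) + A2 (X i ω))| ≤
              2 * (W * (A * M)) := by
            rw [abs_mul, abs_of_pos (inv_pos.2 hn'), inv_mul_le_iff₀ hn']
            calc _ ≤ ∑ i ∈ Finset.range n, |A1 (X i ω) + A2 (X i ω)| :=
                  Finset.abs_sum_le_sum_abs _ _
              _ ≤ ∑ i ∈ Finset.range n, 2 * (W * (A * M)) := Finset.sum_le_sum fun i _ =>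
                  (abs_add_le _ _).trans (by linarith [hA1b (X i ω), hA2b (X i ω)])
              _ = _ := by simp
          linarith
        calc _ ≤ |-((n : ℝ)⁻¹ * s⁻¹ * U ω)| + |s⁻¹ * Z ω| + |s * (c - θ)| +
              |s⁻¹ * ((n : ℝ)⁻¹ * ∑ i ∈ Finset.range n, (A1 (X i ω) + A2 (X i ω)) - θ)| :=
              (abs_add_le _ _).trans (add_le_add (abs_add_three _ _ _) le_rfl)
          _ ≤ _ := by rw [abs_neg]; linarith
    _ = ∫ ω, |(n : ℝ)⁻¹ * s⁻¹ * U ω| ∂P + ∫ ω, |s⁻¹ * Z ω| ∂P +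
          (s * (W * b) + s⁻¹ * (3 * (W * (A * M)))) := by
        rw [integral_add hi3 (integrable_const _), integral_add hiU hiZ]
        simp
    _ ≤ _ := by linarith

end IsBoundedDensitySample

end LinearPart

/-! ### Consequences of the bandwidth conditions. -/

section Bandwidth

variable {d r : ℕ} {h : ℕ → ℝ}

lemma tendsto_inv_sqrt_natCast : Tendsto (fun n : ℕ => (√(n : ℝ))⁻¹) atTop (𝓝 0) :=
  tendsto_inv_atTop_zero.comp (Real.tendsto_sqrt_atTop.comp tendsto_natCast_atTop_atTop)

/-- For `r = 0` the condition would read √n → 0. This supplies the positivity of the order that the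
bias bound requires. -/
lemma ne_zero_of_tendsto_sqrt_mul_pow (hb : Tendsto (fun n : ℕ => √(n : ℝ) * h n ^ r) atTop (𝓝 0)) :
    r ≠ 0 := by
  rintro rfl
  simp only [pow_zero, mul_one] at hb
  exact not_tendsto_nhds_of_tendsto_atTop
    (Real.tendsto_sqrt_atTop.comp tendsto_natCast_atTop_atTop) 0 hb

lemma tendsto_pow_of_tendsto_sqrt_mul_pow (hpos : ∀ n, 0 < h n)
    (hb : Tendsto (fun n : ℕ => √(n : ℝ) * h n ^ r) atTop (𝓝 0)) :
    Tendsto (fun n => h n ^ r) atTop (𝓝 0) := by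
  refine squeeze_zero' (Eventually.of_forall fun n => (pow_pos (hpos n) r).le) ?_ hb
  filter_upwards [eventually_ge_atTop 1] with n hn
  have h1 : (1 : ℝ) ≤ √(n : ℝ) := Real.one_le_sqrt.2 (by exact_mod_cast hn)
  exact le_mul_of_one_le_left (pow_pos (hpos n) r).le h1

lemma tendsto_zero_of_tendsto_sqrt_mul_pow (hpos : ∀ n, 0 < h n)
    (hb : Tendsto (fun n : ℕ => √(n : ℝ) * h n ^ r) atTop (𝓝 0)) :
    Tendsto h atTop (𝓝 0) := by
  have h1 := tendsto_pow_of_tendsto_sqrt_mul_pow hpos hb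
  rw [Metric.tendsto_atTop]
  intro ε hε
  obtain ⟨N, hN⟩ := eventually_atTop.1 (h1.eventually_lt_const (pow_pos hε r))
  refine ⟨N, fun n hn => ?_⟩
  rw [Real.dist_eq, sub_zero, abs_of_pos (hpos n)]
  exact lt_of_pow_lt_pow_left₀ r hε.le (hN n hn)

lemma tendsto_inv_natCast_mul_pow
    (hv : Tendsto (fun n : ℕ => √(n : ℝ) * h n ^ d) atTop atTop) :
    Tendsto (fun n : ℕ => √(n : ℝ) * ((n : ℝ) * h n ^ d)⁻¹) atTop (𝓝 0) := by
  refine (tendsto_inv_atTop_zero.comp hv).congr' ?_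
  filter_upwards [eventually_ge_atTop 1] with n hn
  have h1 : (0 : ℝ) < n := by exact_mod_cast hn
  have h2 : √(n : ℝ) * √(n : ℝ) = n := Real.mul_self_sqrt h1.le
  have h3 : 0 < √(n : ℝ) := Real.sqrt_pos.2 h1
  simp only [Function.comp_apply]
  rw [mul_inv, mul_inv]
  nth_rewrite 3 [← h2]
  field_simp

lemma tendsto_zero_of_tendsto_sqrt_mul {u : ℕ → ℝ} (hu : ∀ n, 0 ≤ u n)
    (h : Tendsto (fun n : ℕ => √(n : ℝ) * u n) atTop (𝓝 0)) : Tendsto u atTop (𝓝 0) := by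
  refine squeeze_zero' (Eventually.of_forall hu) ?_ h
  filter_upwards [eventually_ge_atTop 1] with n hn
  exact le_mul_of_one_le_left (hu n) (Real.one_le_sqrt.2 (by exact_mod_cast hn))

lemma mseBound_nonneg {K : EuclideanSpace ℝ (Fin d) → ℝ} {M : ℝ} (hM : 0 ≤ M) (C : ℝ) {t : ℝ}
    (ht : 0 < t) (n : ℕ) : 0 ≤ mseBound K r M C t n := by
  have : 0 ≤ ∫ u, K u ^ 2 := integral_nonneg fun u => sq_nonneg _
  unfold mseBound
  positivity

/-- The three terms are of order `1 / (√n h^d)`, `(√n h^r) h^r` and `n^{-3/2}`. -/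
lemma tendsto_sqrt_mul_mseBound (K : EuclideanSpace ℝ (Fin d) → ℝ) (M C : ℝ)
    (hpos : ∀ n, 0 < h n)
    (hb : Tendsto (fun n : ℕ => √(n : ℝ) * h n ^ r) atTop (𝓝 0))
    (hv : Tendsto (fun n : ℕ => √(n : ℝ) * h n ^ d) atTop atTop) :
    Tendsto (fun n : ℕ => √(n : ℝ) * mseBound K r M C (h n) n) atTop (𝓝 0) := by
  have h1 := (tendsto_inv_natCast_mul_pow hv).mul_const (3 * ((∫ u, K u ^ 2) * M))
  have h2 := (hb.mul (tendsto_pow_of_tendsto_sqrt_mul_pow hpos hb)).mul_const (3 * C ^ 2)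
  have h3 := ((tendsto_inv_sqrt_natCast.mul tendsto_inv_atTop_nhds_zero_nat)).mul_const
    (3 * ((∫ u, |K u|) * M) ^ 2)
  have h4 := (h1.add h2).add h3
  simp only [zero_mul, add_zero] at h4
  refine h4.congr' ?_
  filter_upwards [eventually_ge_atTop 1] with n hn
  rw [← Real.sqrt_div_self, div_eq_mul_inv, mseBound]
  ring

/-- Eventually `√n * h n ^ d ≥ 1`, so `n * h n ^ d ≥ √n`, and `n * exp (-κ √n)` tends to zero. -/
lemma tendsto_natCast_mul_exp_neg {κ : ℝ} (hκ : 0 < κ)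
    (hv : Tendsto (fun n : ℕ => √(n : ℝ) * h n ^ d) atTop atTop) :
    Tendsto (fun n : ℕ => (n : ℝ) * Real.exp (-κ * (n * h n ^ d))) atTop (𝓝 0) := by
  have h1 : Tendsto (fun n : ℕ => κ * √(n : ℝ)) atTop atTop :=
    (Real.tendsto_sqrt_atTop.comp tendsto_natCast_atTop_atTop).const_mul_atTop hκ
  have h2 := ((Real.tendsto_pow_mul_exp_neg_atTop_nhds_zero 2).comp h1).const_mul ((κ ^ 2)⁻¹)
  rw [mul_zero] at h2
  refine squeeze_zero' (Eventually.of_forall fun n => by positivity) ?_ h2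
  filter_upwards [hv.eventually_ge_atTop 1] with n hn
  have e2 : √(n : ℝ) * √(n : ℝ) = n := Real.mul_self_sqrt n.cast_nonneg
  simp only [Function.comp_apply]
  rw [mul_pow, pow_two √(n : ℝ), e2, mul_assoc (κ ^ 2), inv_mul_cancel_left₀ (by positivity)]
  gcongr
  rw [neg_mul, neg_le_neg_iff]
  gcongr
  calc √(n : ℝ) ≤ √(n : ℝ) * (√(n : ℝ) * h n ^ d) :=
        le_mul_of_one_le_right (Real.sqrt_nonneg _) hn
    _ = n * h n ^ d := by rw [← mul_assoc, e2]

end Bandwidth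

/-! ### Expansion of the reciprocal of the density estimate. -/

section Reciprocal

/-- The second-order remainder is exactly `φ (F - f)² / (F f²)`, and `F f² ≥ b³ / 2`. -/
lemma abs_div_sub_linearization_le {φ F f b : ℝ} (hb : 0 < b) (hf : b ≤ f) (hF : b / 2 < F) :
    |φ / F - (2 * (φ / f ^ 2 * f) - φ / f ^ 2 * F)| ≤ |φ| * (2 / b ^ 3) * (F - f) ^ 2 := by
  have hF0 : 0 < F := by linarith
  have hf0 : 0 < f := by linarith
  have e1 : φ / F - (2 * (φ / f ^ 2 * f) - φ / f ^ 2 * F) =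
      φ * (1 / (F * f ^ 2)) * (F - f) ^ 2 := by
    field_simp
    ring
  rw [e1, abs_mul, abs_mul, abs_of_nonneg (sq_nonneg (F - f)),
    abs_of_pos (by positivity : 0 < 1 / (F * f ^ 2))]
  have e2 : 1 / (F * f ^ 2) ≤ 2 / b ^ 3 := by
    rw [div_le_div_iff₀ (by positivity) (by positivity)]
    have : b / 2 * b ^ 2 ≤ F * f ^ 2 := by gcongr
    nlinarith
  gcongr

/-- Truncating `F` at `b / 2` leaves `f ≥ b` unchanged and is 1-Lipschitz. The estimate thus holds
without any event on which `F` is large, as second moments require. -/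
lemma abs_inv_max_sub_inv_le {F f b : ℝ} (hb : 0 < b) (hf : b ≤ f) :
    |(max F (b / 2))⁻¹ - f⁻¹| ≤ 2 / b ^ 2 * |F - f| := by
  have hf0 : 0 < f := by linarith
  have hm : b / 2 ≤ max F (b / 2) := le_max_right _ _
  have hm0 : 0 < max F (b / 2) := by linarith
  rw [inv_sub_inv hm0.ne' hf0.ne', abs_div, abs_of_pos (by positivity : 0 < max F (b / 2) * f)]
  have h1 : |f - max F (b / 2)| ≤ |F - f| := by
    have := abs_max_sub_max_le_abs F f (b / 2)
    rw [max_eq_left (by linarith : b / 2 ≤ f)] at this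
    rwa [abs_sub_comm]
  have h2 : b / 2 * b ≤ max F (b / 2) * f := by gcongr
  rw [div_mul_eq_mul_div, div_le_div_iff₀ (by positivity) (by positivity)]
  calc |f - max F (b / 2)| * b ^ 2 = |f - max F (b / 2)| * (2 * (b / 2 * b)) := by ring
    _ ≤ |F - f| * (2 * (max F (b / 2) * f)) := by gcongr
    _ = _ := by ring

end Reciprocal

/-! ### Reduction to a sum of independent noise terms. -/

section Remainder

variable {Ω : Type*} [MeasurableSpace Ω] {P : Measure Ω} [IsProbabilityMeasure P] {d r : ℕ}
  {X : ℕ → Ω → EuclideanSpace ℝ (Fin d)} {f K φ s : EuclideanSpace ℝ (Fin d) → ℝ} {M b : ℝ}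
  {h : ℕ → ℝ}

namespace IsBoundedDensitySample

lemma tendsto_measureReal_exists_looKDE_le (hX : IsBoundedDensitySample P X f M)
    (hK : IsExpKernelOfOrder r K) {C : ℝ}
    (hC : ∀ h : ℝ, 0 < h → ∀ x, |kernelSmooth K h f x - f x| ≤ C * h ^ r) (hb : 0 < b)
    (hpos : ∀ n, 0 < h n)
    (hbias : Tendsto (fun n : ℕ => √(n : ℝ) * h n ^ r) atTop (𝓝 0))
    (hvar : Tendsto (fun n : ℕ => √(n : ℝ) * h n ^ d) atTop atTop) :
    Tendsto (fun n => P.real {ω | ∃ i < n, b ≤ f (X i ω) ∧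
      looKDE K (h n) n (fun j => X j ω) i (X i ω) ≤ b / 2}) atTop (𝓝 0) := by
  obtain ⟨CK, hCK0, hCK⟩ := hK.exists_bound
  have hM0 : 0 ≤ M := (hX.nonneg 0).trans (hX.le 0)
  set m2 := (∫ u, K u ^ 2) * M with hm2
  have hm20 : 0 ≤ m2 := mul_nonneg (integral_nonneg fun u => sq_nonneg _) hM0
  -- The two entries of the minimum give the two smallness conditions of the Bernstein bound; `m2 +
  -- 1` avoids dividing by zero.
  set l := min CK⁻¹ (b / (8 * (m2 + 1))) with hl
  have hl0 : 0 < l := lt_min (by positivity) (by positivity)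
  have hlK : l * CK ≤ 1 := by
    calc l * CK ≤ CK⁻¹ * CK := by gcongr; exact min_le_left _ _
      _ = 1 := inv_mul_cancel₀ hCK0.ne'
  have hlM : l * m2 ≤ b / 8 := by
    calc l * m2 ≤ b / (8 * (m2 + 1)) * (m2 + 1) := by
          gcongr
          · exact min_le_right _ _
          · linarith
      _ = b / 8 := by field_simp
  refine squeeze_zero' (Eventually.of_forall fun n => measureReal_nonneg) ?_
    (tendsto_natCast_mul_exp_neg (κ := l * b / 8) (by positivity) hvar)
  have hsmall : ∀ᶠ n in atTop, C * h n ^ r < b / 8 := by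
    have := (tendsto_pow_of_tendsto_sqrt_mul_pow hpos hbias).const_mul C
    rw [mul_zero] at this
    exact this.eventually_lt_const (by positivity)
  filter_upwards [hsmall, eventually_ge_atTop 8] with n hn hn8
  have hn8' : (8 : ℝ) ≤ n := by exact_mod_cast hn8
  -- A bias below `b / 8` leaves `7 * b / 8`, and `8 ≤ n` absorbs the omitted summand: `7 / 8 * (n -
  -- 1) ≥ 3 / 4 * n`.
  have hx : ∀ x, b ≤ f x → 3 * b / 4 * n ≤ ((n : ℝ) - 1) * kernelSmooth K (h n) f x := by
    intro x hx
    have h1 := (abs_le.1 (hC (h n) (hpos n) x)).1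
    have h2 : 7 * b / 8 ≤ kernelSmooth K (h n) f x := by linarith
    calc 3 * b / 4 * n ≤ ((n : ℝ) - 1) * (7 * b / 8) := by nlinarith
      _ ≤ _ := mul_le_mul_of_nonneg_left h2 (by linarith)
  have hsub : {ω | ∃ i < n, b ≤ f (X i ω) ∧
      looKDE K (h n) n (fun j => X j ω) i (X i ω) ≤ b / 2} ⊆
      ⋃ i ∈ Finset.range n, {ω | b ≤ f (X i ω) ∧
        looKDE K (h n) n (fun j => X j ω) i (X i ω) ≤ b / 2} := by
    rintro ω ⟨i, hi, hω⟩
    exact Set.mem_biUnion (Finset.mem_coe.2 (Finset.mem_range.2 hi)) hω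
  calc _ ≤ P.real (⋃ i ∈ Finset.range n, {ω | b ≤ f (X i ω) ∧
        looKDE K (h n) n (fun j => X j ω) i (X i ω) ≤ b / 2}) :=
      measureReal_mono hsub (measure_ne_top P _)
    _ ≤ ∑ i ∈ Finset.range n, P.real {ω | b ≤ f (X i ω) ∧
        looKDE K (h n) n (fun j => X j ω) i (X i ω) ≤ b / 2} :=
        measureReal_biUnion_finset_le _ _
    _ ≤ ∑ i ∈ Finset.range n, Real.exp (-(l * b / 8) * (n * h n ^ d)) :=
        Finset.sum_le_sum fun i hi => hX.measureReal_looKDE_self_le_le hK (hpos n) hl0.le hCK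
          hlK hlM (Finset.mem_range.1 hi) hx
    _ = _ := by simp

lemma tendsto_integral_abs_linearizedError (hX : IsBoundedDensitySample P X f M)
    (hK : IsExpKernelOfOrder r K) {C : ℝ}
    (hC : ∀ h : ℝ, 0 < h → ∀ x, |kernelSmooth K h f x - f x| ≤ C * h ^ r)
    {w : EuclideanSpace ℝ (Fin d) → ℝ} {W : ℝ} (hw : Measurable w) (hW : ∀ x, |w x| ≤ W)
    (hwi : Integrable fun x => w x * f x)
    (hpos : ∀ n, 0 < h n)
    (hbias : Tendsto (fun n : ℕ => √(n : ℝ) * h n ^ r) atTop (𝓝 0))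
    (hvar : Tendsto (fun n : ℕ => √(n : ℝ) * h n ^ d) atTop atTop) :
    Tendsto (fun n => ∫ ω, |linearizedError K w f (h n) n (fun j => X j ω)| ∂P) atTop (𝓝 0) := by
  have hW0 : 0 ≤ W := (abs_nonneg _).trans (hW 0)
  have hq : ∃ B : ℝ, ∀ x, |w x * f x| ≤ B := ⟨W * M, fun x => by
    rw [abs_mul]
    exact mul_le_mul (hW x) (hX.abs_density_le x) (abs_nonneg _) hW0⟩
  have h1 := (tendsto_zero_of_tendsto_sqrt_mul
    (fun n => by have := hpos n; positivity) (tendsto_inv_natCast_mul_pow hvar)).const_mul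
    (2 * (W ^ 2 * ((∫ u, K u ^ 2) * M)))
  rw [mul_zero] at h1
  have h2 := hK.tendsto_integral_abs_kernelSmooth_sub (hw.mul hX.measurable_density) hwi hq
    (tendsto_zero_of_tendsto_sqrt_mul_pow hpos hbias)
  have h3 : Tendsto (fun n => projectionBound K w f M W (C * h n ^ r) (h n)) atTop (𝓝 0) := by
    have e1 := ((((tendsto_pow_of_tendsto_sqrt_mul_pow hpos hbias).const_mul C).const_mul W).pow
      2).const_mul 2
    have e2 := (h2.const_mul (M * ((1 + ∫ u, |K u|) * (W * M)))).const_mul 2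
    have e3 := e1.add e2
    simp only [mul_zero, add_zero, ne_eq, OfNat.ofNat_ne_zero, not_false_eq_true, zero_pow] at e3
    exact e3
  have h4 := hbias.const_mul (W * C)
  have h5 := tendsto_inv_sqrt_natCast.mul_const (3 * (W * ((∫ u, |K u|) * M)))
  have h6 := (((Real.continuous_sqrt.tendsto 0).comp h1).add
    ((Real.continuous_sqrt.tendsto 0).comp h3)).add h4 |>.add h5
  simp only [Real.sqrt_zero, mul_zero, zero_mul, add_zero] at h6
  refine squeeze_zero' (Eventually.of_forall fun n => integral_nonneg fun ω => abs_nonneg _) ?_ h6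
  filter_upwards [eventually_gt_atTop 0] with n hn
  refine (hX.integral_abs_linearizedError_le hK hw hW hwi (hpos n) (hC (h n) (hpos n))
    hn).trans_eq ?_
  simp only [Function.comp_apply]
  ring

/-- Replacing the density by its leave-one-out kernel estimate in the noise term, and removing the
rest of the estimation error, costs `o(1)` in probability. -/
theorem tendstoInMeasure_sub (hX : IsBoundedDensitySample P X f M)
    (hK : IsExpKernelOfOrder r K) (hf : HasBoundedDerivOfOrder r f)
    {e : ℕ → Ω → ℝ} (hem : ∀ i, Measurable (e i)) (he : iIndepFun e P)
    (hXe : IndepFun (fun ω i => X i ω) (fun ω i => e i ω) P)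
    (he2 : ∀ i, MemLp (e i) 2 P) (he0 : ∀ i, ∫ ω, e i ω ∂P = 0) {v : ℝ}
    (hv : ∀ i, ∫ ω, e i ω ^ 2 ∂P = v)
    (hφm : Measurable φ) {Bφ : ℝ} (hφB : ∀ x, |φ x| ≤ Bφ) (hφi : Integrable φ)
    (hsm : Measurable s) {Bs : ℝ} (hsB : ∀ x, |s x| ≤ Bs) (hb : 0 < b)
    (hφf : ∀ x, φ x ≠ 0 → b ≤ f x) (hsf : ∀ x, s x ≠ 0 → b ≤ f x)
    (hpos : ∀ n, 0 < h n)
    (hbias : Tendsto (fun n : ℕ => √(n : ℝ) * h n ^ r) atTop (𝓝 0))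
    (hvar : Tendsto (fun n : ℕ => √(n : ℝ) * h n ^ d) atTop atTop) :
    TendstoInMeasure P (fun (n : ℕ) ω =>
      √(n : ℝ) * ((n : ℝ)⁻¹ * ∑ i ∈ Finset.range n, (φ (X i ω) + s (X i ω) * e i ω) /
        looKDE K (h n) n (fun j => X j ω) i (X i ω) - ∫ x, φ x) -
      (√(n : ℝ))⁻¹ * ∑ i ∈ Finset.range n, s (X i ω) * e i ω / f (X i ω)) atTop 0 := by
  obtain ⟨C, hC0, hC⟩ := hK.exists_bias_bound
    (Nat.pos_of_ne_zero (ne_zero_of_tendsto_sqrt_mul_pow hbias)) hX.measurable_density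
    ⟨M, hX.abs_density_le⟩ hf
  obtain ⟨CK, hCK0, hCK⟩ := hK.exists_bound
  have hfm := hX.measurable_density
  have hXm := hX.measurable
  have hXm' : Measurable fun ω j => X j ω := measurable_pi_lambda _ hXm
  have hM0 : 0 ≤ M := (hX.nonneg 0).trans (hX.le 0)
  have hBφ0 : 0 ≤ Bφ := (abs_nonneg _).trans (hφB 0)
  have hBs0 : 0 ≤ Bs := (abs_nonneg _).trans (hsB 0)
  have hv0 : 0 ≤ v := hv 0 ▸ integral_nonneg fun ω => sq_nonneg _
  -- This weight makes `linearizedError` the first-order part of the sum of `φ / F`, centred at `∫ w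
  -- f² = ∫ φ`.
  set w : EuclideanSpace ℝ (Fin d) → ℝ := fun x => φ x / f x ^ 2 with hw
  have hwm : Measurable w := hφm.div (hfm.pow_const 2)
  have hwB : ∀ x, |w x| ≤ Bφ / b ^ 2 := by
    intro x
    by_cases hx : φ x = 0
    · simp only [hw, hx, zero_div, abs_zero]; positivity
    · have hfx := hφf x hx
      have hfx0 : 0 < f x := hb.trans_le hfx
      simp only [hw, abs_div]
      rw [abs_of_pos (by positivity : 0 < f x ^ 2)]
      have := hφB x
      gcongr
  have hwf : ∀ x, w x * f x ^ 2 = φ x := by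
    intro x
    by_cases hx : φ x = 0
    · simp [hw, hx]
    · have hfx0 : 0 < f x := hb.trans_le (hφf x hx)
      simp only [hw]
      field_simp
  have hwi : Integrable fun x => w x * f x := by
    refine (hφi.norm.const_mul b⁻¹).mono' (hwm.mul hfm).aestronglyMeasurable
      (ae_of_all _ fun x => ?_)
    by_cases hx : φ x = 0
    · simp [hw, hx]
    · have hfx := hφf x hx
      have hfx0 : 0 < f x := hb.trans_le hfx
      have e1 : w x * f x = φ x * (f x)⁻¹ := by simp only [hw]; field_simp
      rw [e1, norm_mul, mul_comm, norm_inv, Real.norm_of_nonneg hfx0.le]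
      gcongr
  set F : ℕ → ℕ → (ℕ → EuclideanSpace ℝ (Fin d)) → ℝ :=
    fun n i z => looKDE K (h n) n z i (z i) with hF
  have hFm : ∀ n i, Measurable (F n i) := fun n i => measurable_looKDE_self hK.measurable _ _ _
  set Δ : ℕ → ℕ → Ω → ℝ := fun n i ω => F n i (fun j => X j ω) - f (X i ω) with hΔ
  have hΔm : ∀ n i, Measurable (Δ n i) := fun n i =>
    ((hFm n i).comp hXm').sub (hfm.comp (hXm i))
  have hΔi : ∀ n i, Integrable (fun ω => Δ n i ω ^ 2) P := fun n i =>
    MemLp.integrable_sq (MemLp.of_bound (hΔm n i).aestronglyMeasurable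
      (((n : ℝ) * h n ^ d)⁻¹ * (n * CK) + M) (ae_of_all _ fun ω =>
        (norm_sub_le _ _).trans
          (add_le_add (abs_looKDE_le hCK (hpos n) n i _ _) (hX.abs_density_le _))))
  have hΔb : ∀ n i, i < n → ∫ ω, Δ n i ω ^ 2 ∂P ≤ mseBound K r M C (h n) n := fun n i hi =>
    hX.integral_sq_looKDE_self_sub_le hK (hpos n) (hC (h n) (hpos n)) hi
  -- The truncated weight is bounded everywhere and is a function of the design alone, so the noise
  -- lemma applies; on the good event the truncation is inactive.
  set m : ℕ → ℕ → (ℕ → EuclideanSpace ℝ (Fin d)) → ℝ := fun n i z =>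
    s (z i) * ((max (F n i z) (b / 2))⁻¹ - (f (z i))⁻¹) with hm
  have hmm : ∀ n i, Measurable (m n i) := by
    intro n i
    have := hFm n i
    simp only [hm]
    fun_prop
  have hmb : ∀ n i z, |m n i z| ≤ Bs * (2 / b ^ 2 * |F n i z - f (z i)|) := by
    intro n i z
    by_cases hx : s (z i) = 0
    · simp only [hm, hx, zero_mul, abs_zero]; positivity
    · simp only [hm, abs_mul]
      exact mul_le_mul (hsB _) (abs_inv_max_sub_inv_le hb (hsf _ hx)) (abs_nonneg _) hBs0
  have hmB : ∀ n i z, |m n i z| ≤ Bs * (2 / b ^ 2 * (((n : ℝ) * h n ^ d)⁻¹ * (n * CK) + M)) := by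
    intro n i z
    refine (hmb n i z).trans ?_
    have : |F n i z - f (z i)| ≤ ((n : ℝ) * h n ^ d)⁻¹ * (n * CK) + M :=
      (abs_sub _ _).trans (add_le_add (abs_looKDE_le hCK (hpos n) n i _ _) (hX.abs_density_le _))
    gcongr
  set V : ℕ → Ω → ℝ := fun n ω => linearizedError K w f (h n) n (fun j => X j ω) with hV
  set R : ℕ → Ω → ℝ := fun n ω => √(n : ℝ) * ((n : ℝ)⁻¹ * ∑ i ∈ Finset.range n,
    Bφ * (2 / b ^ 3) * Δ n i ω ^ 2) with hR
  set N : ℕ → Ω → ℝ := fun n ω => (√(n : ℝ))⁻¹ * ∑ i ∈ Finset.range n,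
    m n i (fun j => X j ω) * e i ω with hN
  have hVi : ∀ n, Integrable (fun ω => |V n ω|) P := fun n => by
    obtain ⟨B, hB⟩ := abs_linearizedError_le hX hCK hwB (hpos n) n
    exact integrable_of_abs_le
      (((measurable_linearizedError hK.measurable hwm hfm (h n) n).comp hXm').abs) (M := B)
      fun ω => by rw [abs_abs]; exact hB _
  have hRi : ∀ n, Integrable (R n) P := fun n =>
    ((integrable_finsetSum _ fun i _ => (hΔi n i).const_mul _).const_mul _).const_mul _
  have hN2 : ∀ n, MemLp (fun ω => ∑ i ∈ Finset.range n, m n i (fun j => X j ω) * e i ω) 2 P :=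
    fun n => memLp_finsetSum _ fun i _ => by
      refine (he2 i).of_le_mul (c := Bs * (2 / b ^ 2 * (((n : ℝ) * h n ^ d)⁻¹ * (n * CK) + M)))
        (((hmm n i).comp hXm').mul (hem i)).aestronglyMeasurable (ae_of_all _ fun ω => ?_)
      rw [norm_mul]
      gcongr
      exact hmB n i (fun j => X j ω)
  have hNi : ∀ n, Integrable (fun ω => |N n ω|) P := fun n =>
    (((hN2 n).const_mul _).integrable (by norm_num)).abs
  have hVlim : Tendsto (fun n => ∫ ω, |V n ω| ∂P) atTop (𝓝 0) :=
    hX.tendsto_integral_abs_linearizedError hK hC hwm hwB hwi hpos hbias hvar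
  have hδ := tendsto_sqrt_mul_mseBound K M C hpos hbias hvar
  have hδ' := tendsto_zero_of_tendsto_sqrt_mul (fun n => mseBound_nonneg hM0 C (hpos n) n) hδ
  have hRlim : Tendsto (fun n => ∫ ω, R n ω ∂P) atTop (𝓝 0) := by
    have h1 := hδ.const_mul (Bφ * (2 / b ^ 3))
    rw [mul_zero] at h1
    refine squeeze_zero (fun n => integral_nonneg fun ω => ?_) (fun n => ?_) h1
    · simp only [hR]; positivity
    · simp only [hR]
      rw [integral_const_mul, integral_const_mul,
        integral_finsetSum _ fun i _ => (hΔi n i).const_mul _]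
      simp only [integral_const_mul]
      rcases Nat.eq_zero_or_pos n with rfl | hn
      · simp
      have hn' : (0 : ℝ) < n := by exact_mod_cast hn
      have h2 : ∑ i ∈ Finset.range n, Bφ * (2 / b ^ 3) * ∫ ω, Δ n i ω ^ 2 ∂P ≤
          n * (Bφ * (2 / b ^ 3) * mseBound K r M C (h n) n) := by
        calc _ ≤ ∑ i ∈ Finset.range n, Bφ * (2 / b ^ 3) * mseBound K r M C (h n) n :=
              Finset.sum_le_sum fun i hi => mul_le_mul_of_nonneg_left
                (hΔb n i (Finset.mem_range.1 hi)) (by positivity)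
          _ = _ := by simp
      calc _ ≤ √(n : ℝ) * ((n : ℝ)⁻¹ * (n * (Bφ * (2 / b ^ 3) * mseBound K r M C (h n) n))) :=
            mul_le_mul_of_nonneg_left (mul_le_mul_of_nonneg_left h2 (by positivity))
              (Real.sqrt_nonneg _)
        _ = _ := by rw [inv_mul_cancel_left₀ hn'.ne']; ring
  have hNlim : Tendsto (fun n => ∫ ω, |N n ω| ∂P) atTop (𝓝 0) := by
    have h1 := (Real.continuous_sqrt.tendsto 0).comp
      ((hδ'.const_mul (v * (Bs * (2 / b ^ 2)) ^ 2)).trans_eq (by rw [mul_zero]))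
    rw [Real.sqrt_zero] at h1
    refine squeeze_zero' (Eventually.of_forall fun n => integral_nonneg fun ω => abs_nonneg _)
      ?_ h1
    filter_upwards [eventually_gt_atTop 0] with n hn
    have hn' : (0 : ℝ) < n := by exact_mod_cast hn
    refine integral_abs_le_sqrt_of_integral_sq_le ((hN2 n).const_mul _) ?_
    simp only [mul_pow]
    rw [integral_const_mul,
      integral_sq_sum_mul_noise hXm hem he hXe he2 he0 hv (hmm n) (hmB n), inv_pow,
      Real.sq_sqrt hn'.le]
    have h2 : ∀ i ∈ Finset.range n, ∫ ω, m n i (fun j => X j ω) ^ 2 ∂P ≤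
        (Bs * (2 / b ^ 2)) ^ 2 * mseBound K r M C (h n) n := by
      intro i hi
      calc ∫ ω, m n i (fun j => X j ω) ^ 2 ∂P
          ≤ ∫ ω, (Bs * (2 / b ^ 2)) ^ 2 * Δ n i ω ^ 2 ∂P := by
            refine integral_mono_of_nonneg (ae_of_all _ fun ω => sq_nonneg _)
              ((hΔi n i).const_mul _) (ae_of_all _ fun ω => ?_)
            beta_reduce
            rw [← mul_pow, ← sq_abs, ← sq_abs (_ * _)]
            refine pow_le_pow_left₀ (abs_nonneg _) ((hmb n i (fun j => X j ω)).trans_eq ?_) 2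
            rw [abs_mul, abs_of_nonneg (by positivity : 0 ≤ Bs * (2 / b ^ 2)), mul_assoc]
        _ = (Bs * (2 / b ^ 2)) ^ 2 * ∫ ω, Δ n i ω ^ 2 ∂P := integral_const_mul _ _
        _ ≤ _ := mul_le_mul_of_nonneg_left (hΔb n i (Finset.mem_range.1 hi)) (sq_nonneg _)
    calc _ ≤ (n : ℝ)⁻¹ * (v * ∑ i ∈ Finset.range n,
          (Bs * (2 / b ^ 2)) ^ 2 * mseBound K r M C (h n) n) :=
          mul_le_mul_of_nonneg_left (mul_le_mul_of_nonneg_left (Finset.sum_le_sum h2) hv0)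
            (by positivity)
      _ = _ := by
          rw [Finset.sum_const, Finset.card_range, nsmul_eq_mul]
          field_simp
  refine tendstoInMeasure_zero_of_abs_le_off (D' := fun n ω => |V n ω| + R n ω + |N n ω|)
    (hX.tendsto_measureReal_exists_looKDE_le hK hC hb hpos hbias hvar) ?_
    (fun n ω => ?_) (fun n => ((hVi n).add (hRi n)).add (hNi n)) ?_
  · filter_upwards [eventually_gt_atTop 0] with n hn
    intro ω hω
    have hn' : (0 : ℝ) < n := by exact_mod_cast hn
    have hsn : √(n : ℝ) * (n : ℝ)⁻¹ = (√(n : ℝ))⁻¹ := by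
      rw [← div_eq_mul_inv, Real.sqrt_div_self]
    have hgood : ∀ i < n, b ≤ f (X i ω) → b / 2 < F n i (fun j => X j ω) := by
      intro i hi hfi
      by_contra hcon
      exact hω ⟨i, hi, hfi, not_lt.1 hcon⟩
    -- Where `s` vanishes both sides are zero whatever the estimate, even if it is zero. Elsewhere
    -- `f ≥ b` and the good event applies; the same dichotomy governs `hρb`.
    have hnoise : ∀ i ∈ Finset.range n, s (X i ω) * e i ω / F n i (fun j => X j ω) -
        s (X i ω) * e i ω / f (X i ω) = m n i (fun j => X j ω) * e i ω := by
      intro i hi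
      by_cases hx : s (X i ω) = 0
      · simp [hm, hx]
      · have h1 := hgood i (Finset.mem_range.1 hi) (hsf _ hx)
        simp only [hm]
        rw [max_eq_left h1.le]
        ring
    set ρ : ℕ → ℝ := fun i => φ (X i ω) / F n i (fun j => X j ω) -
      (2 * (w (X i ω) * f (X i ω)) - w (X i ω) * F n i (fun j => X j ω)) with hρ
    have hρb : ∀ i ∈ Finset.range n, |ρ i| ≤ Bφ * (2 / b ^ 3) * Δ n i ω ^ 2 := by
      intro i hi
      by_cases hx : φ (X i ω) = 0
      · simp only [hρ, hw, hx, zero_div, zero_mul, mul_zero, sub_zero, abs_zero]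
        positivity
      · refine (abs_div_sub_linearization_le hb (hφf _ hx)
          (hgood i (Finset.mem_range.1 hi) (hφf _ hx))).trans ?_
        have := hφB (X i ω)
        simp only [hΔ]
        gcongr
    have hdec : √(n : ℝ) * ((n : ℝ)⁻¹ * ∑ i ∈ Finset.range n,
        (φ (X i ω) + s (X i ω) * e i ω) / looKDE K (h n) n (fun j => X j ω) i (X i ω) -
        ∫ x, φ x) - (√(n : ℝ))⁻¹ * ∑ i ∈ Finset.range n, s (X i ω) * e i ω / f (X i ω) =
        V n ω + √(n : ℝ) * ((n : ℝ)⁻¹ * ∑ i ∈ Finset.range n, ρ i) + N n ω := by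
      simp only [hN]
      rw [← Finset.sum_congr rfl hnoise]
      simp only [hV, linearizedError, hρ, hwf, Finset.sum_sub_distrib, add_div,
        Finset.sum_add_distrib, ← hsn, hF]
      ring
    rw [hdec]
    refine (abs_add_three _ _ _).trans ?_
    gcongr
    rw [abs_mul, abs_mul, abs_of_nonneg (Real.sqrt_nonneg _), abs_of_pos (inv_pos.2 hn')]
    simp only [hR]
    gcongr
    exact (Finset.abs_sum_le_sum_abs _ _).trans (Finset.sum_le_sum hρb)
  · have : 0 ≤ R n ω := by simp only [hR]; positivity
    positivity
  · have h1 := (hVlim.add hRlim).add hNlim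
    simp only [add_zero] at h1
    refine h1.congr fun n => ?_
    have h2 : Integrable (fun ω => |V n ω| + R n ω) P := (hVi n).add (hRi n)
    rw [integral_add h2 (hNi n), integral_add (hVi n) (hRi n)]

end IsBoundedDensitySample

end Remainder

/-! ### Moments of noise weighted by the design, and bounds on `Q`. -/

section WeightedNoise

variable {Ω : Type*} [MeasurableSpace Ω] {P : Measure Ω} {α : Type*} [MeasurableSpace α]

lemma memLp_comp_mul_of_abs_le {x : Ω → α} {e : Ω → ℝ} (hx : Measurable x)
    (he : MemLp e 2 P) {u : α → ℝ} (hu : Measurable u) {B : ℝ} (hB : ∀ x, |u x| ≤ B) :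
    MemLp (fun ω => u (x ω) * e ω) 2 P := by
  refine he.of_le_mul (c := B) ((hu.comp hx).aestronglyMeasurable.mul he.aestronglyMeasurable)
    (ae_of_all _ fun ω => ?_)
  rw [norm_mul]
  gcongr
  exact hB _

lemma ProbabilityTheory.IndepFun.integral_comp_mul_eq_zero {x : Ω → α} {e : Ω → ℝ}
    (h : IndepFun x e P) (hx : Measurable x) (he : Measurable e) (he0 : ∫ ω, e ω ∂P = 0)
    {u : α → ℝ} (hu : Measurable u) : ∫ ω, u (x ω) * e ω ∂P = 0 := by
  have := (h.comp hu measurable_id).integral_fun_mul_eq_mul_integral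
    (hu.comp hx).aestronglyMeasurable he.aestronglyMeasurable
  simpa [he0] using this

/-- Centred noise weighted by a function of the design is uncorrelated with every bounded function
of the design. -/
lemma ProbabilityTheory.IndepFun.variance_comp_mul_add [IsProbabilityMeasure P] {x : Ω → α}
    {e : Ω → ℝ} (h : IndepFun x e P) (hx : Measurable x) (hem : Measurable e) (he : MemLp e 2 P)
    (he0 : ∫ ω, e ω ∂P = 0) {u q : α → ℝ} (hu : Measurable u) {B : ℝ} (hB : ∀ x, |u x| ≤ B)
    (hq : Measurable q) {B' : ℝ} (hB' : ∀ x, |q x| ≤ B') :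
    Var[fun ω => u (x ω) * e ω + q (x ω); P] =
      Var[fun ω => u (x ω) * e ω; P] + Var[fun ω => q (x ω); P] := by
  have h1 := memLp_comp_mul_of_abs_le (P := P) hx he hu hB
  have h2 : MemLp (fun ω => q (x ω)) 2 P :=
    MemLp.of_bound (hq.comp hx).aestronglyMeasurable B' (ae_of_all _ fun ω => hB' _)
  rw [_root_.ProbabilityTheory.variance_fun_add h1 h2, covariance_eq_sub h1 h2,
    h.integral_comp_mul_eq_zero hx hem he0 hu]
  have h3 := h.integral_comp_mul_eq_zero hx hem he0 (hu.mul hq)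
  have h4 : ∫ ω, ((fun ω => u (x ω) * e ω) * fun ω => q (x ω)) ω ∂P = 0 := by
    rw [← h3]
    congr 1 with ω
    simp only [Pi.mul_apply]
    ring
  rw [h4]
  ring

lemma variance_sqrt_mul_mean_sub [IsProbabilityMeasure P] {T : ℕ → Ω → ℝ}
    (hT : ∀ i, MemLp (T i) 2 P) (hind : iIndepFun T P) (hid : ∀ i, IdentDistrib (T i) (T 0) P P)
    (c : ℝ) {n : ℕ} (hn : 1 ≤ n) :
    Var[fun ω => √(n : ℝ) * ((n : ℝ)⁻¹ * ∑ i ∈ Finset.range n, T i ω - c); P] =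
      Var[T 0; P] := by
  have hn' : (0 : ℝ) < n := by exact_mod_cast hn
  have hs : MemLp (fun ω => ∑ i ∈ Finset.range n, T i ω) 2 P := memLp_finsetSum _ fun i _ => hT i
  have h1 : Var[fun ω => ∑ i ∈ Finset.range n, T i ω; P] = ∑ i ∈ Finset.range n, Var[T i; P] := by
    rw [← IndepFun.variance_sum (fun i _ => hT i) fun i _ j _ hij => hind.indepFun hij]
    congr 1 with ω
    rw [Finset.sum_apply]
  rw [variance_const_mul, variance_sub_const (hs.const_mul _).aestronglyMeasurable,
    variance_const_mul, h1, Finset.sum_congr rfl fun i _ => (hid i).variance_eq,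
    Real.sq_sqrt hn'.le]
  rw [Finset.sum_const, Finset.card_range, nsmul_eq_mul]
  field_simp

/-- A Hölder map sends a set of finite diameter to one of finite diameter. -/
lemma IsHolderOn.exists_bound {d : ℕ} {φ : EuclideanSpace ℝ (Fin d) → ℝ}
    {Q : Set (EuclideanSpace ℝ (Fin d))} (hφ : IsHolderOn φ Q) (hQ : Bornology.IsBounded Q) :
    ∃ B : ℝ, ∀ x ∈ Q, |φ x| ≤ B := by
  obtain ⟨C, a, -, -, h⟩ := hφ
  have hb : Bornology.IsBounded (φ '' Q) := by
    rw [Metric.isBounded_iff_ediam_ne_top]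
    refine ne_top_of_le_ne_top ?_ h.ediam_image_le
    exact ENNReal.mul_ne_top ENNReal.coe_ne_top (ENNReal.rpow_ne_top_of_nonneg a.coe_nonneg
      (Metric.isBounded_iff_ediam_ne_top.1 hQ))
  obtain ⟨B, hB⟩ := hb.exists_norm_le
  exact ⟨B, fun x hx => hB _ (Set.mem_image_of_mem _ hx)⟩

lemma integrable_of_abs_le_of_support_subset {d : ℕ} {φ : EuclideanSpace ℝ (Fin d) → ℝ}
    (hφ : Measurable φ) {B : ℝ} (hB : ∀ x, |φ x| ≤ B) {Q : Set (EuclideanSpace ℝ (Fin d))}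
    (hQ : Bornology.IsBounded Q) (h0 : ∀ x, x ∉ Q → φ x = 0) : Integrable φ := by
  obtain ⟨R, hR⟩ := hQ.subset_closedBall 0
  have h1 : IntegrableOn φ (Metric.closedBall 0 R) :=
    IntegrableOn.of_bound measure_closedBall_lt_top hφ.aestronglyMeasurable B
      (ae_of_all _ hB)
  exact h1.integrable_of_forall_notMem_eq_zero fun x hx => h0 x fun hxQ => hx (hR hxQ)

end WeightedNoise

/-! ### The limit theorem and the comparison of variances. -/

theorem theorem2 {Ω : Type*} [MeasurableSpace Ω] (P : Measure Ω) [IsProbabilityMeasure P]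
    (d : ℕ) (hd : 1 ≤ d) (r : ℕ)
    -- the random-design regression model
    (X : ℕ → Ω → EuclideanSpace ℝ (Fin d)) (e : ℕ → Ω → ℝ) (Y : ℕ → Ω → ℝ)
    (g σ : EuclideanSpace ℝ (Fin d) → ℝ)
    (hX_meas : ∀ i, Measurable (X i)) (he_meas : ∀ i, Measurable (e i))
    (hg_meas : Measurable g) (hσ_meas : Measurable σ)
    (hX_indep : iIndepFun X P) (hX_ident : ∀ i, IdentDistrib (X i) (X 0) P P)
    (he_indep : iIndepFun e P) (he_ident : ∀ i, IdentDistrib (e i) (e 0) P P)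
    (hXe : IndepFun (fun ω i => X i ω) (fun ω i => e i ω) P)
    (he_sq : MemLp (e 0) 2 P) (he_mean : ∫ ω, e 0 ω ∂P = 0)
    (hY : ∀ i ω, Y i ω = g (X i ω) + σ (X i ω) * e i ω)
    -- the density of the design
    (f : EuclideanSpace ℝ (Fin d) → ℝ) (hf : IsDensityOf P (X 0) f)
    (hf_bdd : ∃ M : ℝ, ∀ x, f x ≤ M) (hf_smooth : HasBoundedDerivOfOrder r f)
    -- the set `Q`, and the lower bound on the density there
    (Q : Set (EuclideanSpace ℝ (Fin d))) (hQ_ne : Q.Nonempty) (hQ_bdd : Bornology.IsBounded Q)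
    (hQ_conv : Convex ℝ Q) (hfQ : ∃ b : ℝ, 0 < b ∧ ∀ x ∈ Q, b ≤ f x)
    -- the kernel
    (K : EuclideanSpace ℝ (Fin d) → ℝ) (hK : IsExpKernelOfOrder r K)
    -- the weight function, the regression function and the noise level
    (ψ : EuclideanSpace ℝ (Fin d) → ℝ) (hψ_meas : Measurable ψ) (hψ : IsHolderOn ψ Q)
    (hψ_supp : ∀ x, x ∉ Q → ψ x = 0)
    (hg : IsHolderOn g Q) (hσ_bdd : ∃ M : ℝ, ∀ x, |σ x| ≤ M)
    -- the bandwidth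
    (h : ℕ → ℝ) (hh_pos : ∀ n, 0 < h n)
    (hh_bias : Tendsto (fun n : ℕ => √(n : ℝ) * h n ^ r) atTop (𝓝 0))
    (hh_var : Tendsto (fun n : ℕ => √(n : ℝ) * h n ^ d) atTop atTop) :
    Integrable (fun x => g x * ψ x) volume ∧
    MemLp (fun ω => (Y 0 ω - g (X 0 ω)) / f (X 0 ω) * ψ (X 0 ω)) 2 P ∧
    TendstoInDistribution
      (fun (n : ℕ) ω => √(n : ℝ) *
        (cHat K (h n) ψ n (fun i => X i ω) (fun i => Y i ω) - ∫ x, g x * ψ x))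
      atTop (id : ℝ → ℝ) (fun _ => P)
      (gaussianReal 0
        (Var[fun ω => (Y 0 ω - g (X 0 ω)) / f (X 0 ω) * ψ (X 0 ω); P]).toNNReal) ∧
    -- comparison with the estimator that uses the true density
    MemLp (fun ω => Y 0 ω / f (X 0 ω) * ψ (X 0 ω)) 2 P ∧
    Var[fun ω => (Y 0 ω - g (X 0 ω)) / f (X 0 ω) * ψ (X 0 ω); P] =
      Var[fun ω => Y 0 ω / f (X 0 ω) * ψ (X 0 ω); P] -
        Var[fun ω => g (X 0 ω) / f (X 0 ω) * ψ (X 0 ω); P] ∧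
    ∀ n : ℕ, 1 ≤ n →
      Var[fun ω => (Y 0 ω - g (X 0 ω)) / f (X 0 ω) * ψ (X 0 ω); P] ≤
        Var[fun ω => √(n : ℝ) *
          (cTilde f ψ n (fun i => X i ω) (fun i => Y i ω) - ∫ x, g x * ψ x); P] := by
  obtain ⟨hfm, hf0, hfmap⟩ := hf
  obtain ⟨M, hM⟩ := hf_bdd
  obtain ⟨b, hb, hbQ⟩ := hfQ
  obtain ⟨Bψ, hBψ⟩ := hψ.exists_bound hQ_bdd
  obtain ⟨Bg, hBg⟩ := hg.exists_bound hQ_bdd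
  obtain ⟨Bσ, hBσ⟩ := hσ_bdd
  have hX : IsBoundedDensitySample P X f M :=
    ⟨hX_meas, hX_indep, fun i => (hX_ident i).map_eq.trans hfmap, hfm, hf0, hM⟩
  obtain ⟨x₀, hx₀⟩ := hQ_ne
  have hBψ0 : 0 ≤ Bψ := (abs_nonneg _).trans (hBψ x₀ hx₀)
  have hBg0 : 0 ≤ Bg := (abs_nonneg _).trans (hBg x₀ hx₀)
  have hBσ0 : 0 ≤ Bσ := (abs_nonneg _).trans (hBσ x₀)
  have hψQ : ∀ x, ψ x ≠ 0 → x ∈ Q := fun x hx => not_imp_comm.1 (hψ_supp x) hx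
  set φ : EuclideanSpace ℝ (Fin d) → ℝ := fun x => g x * ψ x with hφ
  set s : EuclideanSpace ℝ (Fin d) → ℝ := fun x => σ x * ψ x with hs
  have hφm : Measurable φ := hg_meas.mul hψ_meas
  have hsm : Measurable s := hσ_meas.mul hψ_meas
  -- Off `Q` the factor `ψ` vanishes, so bounds on `Q` suffice although `g` may be unbounded
  -- elsewhere.
  have hφB : ∀ x, |φ x| ≤ Bg * Bψ := by
    intro x
    by_cases hx : ψ x = 0
    · simp only [hφ, hx, mul_zero, abs_zero]; positivity
    · rw [hφ, abs_mul]
      exact mul_le_mul (hBg x (hψQ x hx)) (hBψ x (hψQ x hx)) (abs_nonneg _) hBg0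
  have hsB : ∀ x, |s x| ≤ Bσ * Bψ := by
    intro x
    by_cases hx : ψ x = 0
    · simp only [hs, hx, mul_zero, abs_zero]; positivity
    · rw [hs, abs_mul]
      exact mul_le_mul (hBσ x) (hBψ x (hψQ x hx)) (abs_nonneg _) hBσ0
  have hφi : Integrable φ := integrable_of_abs_le_of_support_subset hφm hφB hQ_bdd
    fun x hx => by simp only [hφ, hψ_supp x hx, mul_zero]
  have hφf : ∀ x, φ x ≠ 0 → b ≤ f x := fun x hx => hbQ x (hψQ x (right_ne_zero_of_mul hx))
  have hsf : ∀ x, s x ≠ 0 → b ≤ f x := fun x hx => hbQ x (hψQ x (right_ne_zero_of_mul hx))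
  have hdiv : ∀ {t : EuclideanSpace ℝ (Fin d) → ℝ} {B : ℝ}, (∀ x, |t x| ≤ B) →
      (∀ x, t x ≠ 0 → b ≤ f x) → ∀ x, |t x / f x| ≤ B / b := by
    intro t B hB htf x
    have hB0 : 0 ≤ B := (abs_nonneg _).trans (hB x)
    by_cases hx : t x = 0
    · rw [hx, zero_div, abs_zero]; positivity
    · have hfx := htf x hx
      rw [abs_div, abs_of_pos (hb.trans_le hfx)]
      have := hB x
      gcongr
  set u : EuclideanSpace ℝ (Fin d) → ℝ := fun x => s x / f x with hu
  set q : EuclideanSpace ℝ (Fin d) → ℝ := fun x => φ x / f x with hq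
  have hum : Measurable u := hsm.div hfm
  have hqm : Measurable q := hφm.div hfm
  have huB : ∀ x, |u x| ≤ Bσ * Bψ / b := hdiv hsB hsf
  have hqB : ∀ x, |q x| ≤ Bg * Bψ / b := hdiv hφB hφf
  have he2 : ∀ i, MemLp (e i) 2 P := fun i => (he_ident i).memLp_iff.2 he_sq
  have he0 : ∀ i, ∫ ω, e i ω ∂P = 0 := fun i => (he_ident i).integral_eq.trans he_mean
  have hev : ∀ i, ∫ ω, e i ω ^ 2 ∂P = ∫ ω, e 0 ω ^ 2 ∂P := fun i =>
    ((he_ident i).comp (u := fun t : ℝ => t ^ 2) (by fun_prop)).integral_eq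
  have hXei : ∀ i, IndepFun (X i) (e i) P := fun i =>
    hXe.comp (measurable_pi_apply i) (measurable_pi_apply i)
  have hpair : iIndepFun (fun i ω => (X i ω, e i ω)) P :=
    iIndepFun_prodMk hX_meas he_meas hX_indep he_indep hXe
  have hpair_id : ∀ i, IdentDistrib (fun ω => (X i ω, e i ω)) (fun ω => (X 0 ω, e 0 ω)) P P :=
    fun i => (hX_ident i).prodMk (he_ident i) (hXei i) (hXei 0)
  set W : ℕ → Ω → ℝ := fun i ω => u (X i ω) * e i ω with hW
  set T : ℕ → Ω → ℝ := fun i ω => u (X i ω) * e i ω + q (X i ω) with hT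
  have hW2 : ∀ i, MemLp (W i) 2 P := fun i => memLp_comp_mul_of_abs_le (hX_meas i) (he2 i) hum huB
  have hq2 : ∀ i, MemLp (fun ω => q (X i ω)) 2 P := fun i =>
    MemLp.of_bound (hqm.comp (hX_meas i)).aestronglyMeasurable _ (ae_of_all _ fun ω => hqB _)
  have hT2 : ∀ i, MemLp (T i) 2 P := fun i => (hW2 i).add (hq2 i)
  have hkW : Measurable fun p : EuclideanSpace ℝ (Fin d) × ℝ => u p.1 * p.2 := by fun_prop
  have hkT : Measurable fun p : EuclideanSpace ℝ (Fin d) × ℝ => u p.1 * p.2 + q p.1 := by fun_prop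
  have hWind : iIndepFun W P := hpair.comp (fun _ p => u p.1 * p.2) fun _ => hkW
  have hTind : iIndepFun T P := hpair.comp (fun _ p => u p.1 * p.2 + q p.1) fun _ => hkT
  have hWid : ∀ i, IdentDistrib (W i) (W 0) P P := fun i => (hpair_id i).comp hkW
  have hTid : ∀ i, IdentDistrib (T i) (T 0) P P := fun i => (hpair_id i).comp hkT
  have hW0 : ∫ ω, W 0 ω ∂P = 0 :=
    (hXei 0).integral_comp_mul_eq_zero (hX_meas 0) (he_meas 0) he_mean hum
  -- The rearrangement needs no `f ≠ 0`: division is multiplication by the inverse, with `0⁻¹ = 0`.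
  have hWeq : (fun ω => (Y 0 ω - g (X 0 ω)) / f (X 0 ω) * ψ (X 0 ω)) = W 0 := by
    ext ω
    simp only [hW, hu, hs, hY]
    ring
  have hTeq : (fun ω => Y 0 ω / f (X 0 ω) * ψ (X 0 ω)) = T 0 := by
    ext ω
    simp only [hT, hu, hq, hs, hφ, hY]
    ring
  have hqeq : (fun ω => g (X 0 ω) / f (X 0 ω) * ψ (X 0 ω)) = fun ω => q (X 0 ω) := by
    ext ω
    simp only [hq, hφ]
    ring
  have hTilde : ∀ n : ℕ, (fun ω => √(n : ℝ) *
      (cTilde f ψ n (fun i => X i ω) (fun i => Y i ω) - ∫ x, φ x)) =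
      fun ω => √(n : ℝ) * ((n : ℝ)⁻¹ * ∑ i ∈ Finset.range n, T i ω - ∫ x, φ x) := by
    intro n
    ext ω
    rw [cTilde]
    congr 4 with i
    simp only [hT, hu, hq, hs, hφ, hY]
    ring
  have hvar : Var[T 0; P] = Var[W 0; P] + Var[fun ω => q (X 0 ω); P] :=
    (hXei 0).variance_comp_mul_add (hX_meas 0) (he_meas 0) he_sq he_mean hum huB hqm hqB
  rw [hWeq, hTeq, hqeq]
  refine ⟨hφi, hW2 0, ?_, hT2 0, by rw [hvar]; ring, fun n hn => ?_⟩
  -- Central limit theorem for the noise sum; the remainder tends to zero in probability, so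
  -- Slutsky's lemma transfers the limit.
  · have hclt := tendstoInDistribution_inv_sqrt_mul_sum_sub
      (HasLaw.id (μ := gaussianReal 0 (Var[W 0; P]).toNNReal)) (hW2 0) hWind hWid
    simp only [hW0, mul_zero, sub_zero] at hclt
    refine tendstoInDistribution_of_tendstoInMeasure_sub _ _ hclt ?_ fun n => ?_
    · refine (hX.tendstoInMeasure_sub hK hf_smooth he_meas he_indep hXe he2 he0 hev hφm hφB hφi
        hsm hsB hb hφf hsf hh_pos hh_bias hh_var).congr_left fun n => ae_of_all _ fun ω => ?_
      simp only [Pi.sub_apply, cHat]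
      have e1 : ∀ i, Y i ω * ψ (X i ω) = φ (X i ω) + s (X i ω) * e i ω := fun i => by
        simp only [hφ, hs, hY]; ring
      have e2 : ∀ i, W i ω = s (X i ω) * e i ω / f (X i ω) := fun i => by
        simp only [hW, hu]; ring
      simp only [e1, e2]
    · have hYm : ∀ i, Measurable (Y i) := fun i => by
        have : Y i = fun ω => g (X i ω) + σ (X i ω) * e i ω := funext (hY i)
        rw [this]
        exact (hg_meas.comp (hX_meas i)).add ((hσ_meas.comp (hX_meas i)).mul (he_meas i))
      refine Measurable.aemeasurable (((Measurable.const_mul (Finset.measurable_sum _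
        fun i _ => ?_) _).sub_const _).const_mul _)
      exact ((hYm i).mul (hψ_meas.comp (hX_meas i))).div
        ((measurable_looKDE_self hK.measurable (h n) n i).comp (measurable_pi_lambda _ hX_meas))
  -- The estimator with the true density is a mean of independent copies of `T 0`; its excess
  -- variance is that of `q (X 0)`.
  · rw [hTilde, variance_sqrt_mul_mean_sub hT2 hTind hTid _ hn, hvar]
    exact le_add_of_nonneg_right (variance_nonneg _ _)
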